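/- Let $\beta>0$, $h\in\mathbb R$, $p\in[0,1/2)$ and $S\in(-1,1)$. For each $n\ge 1$ let $X\in\{-1,1\}^n$ have the Curie–Weiss law $$\mathbb P(X=x)=\frac{1}{Z_n(\beta,h)}\exp\Big(\frac{\beta}{2n}\Big(\sum_{i=1}^n x_i\Big)^2+h\sum_{i=1}^n x_i\Big),\qquad x\in\{-1,1\}^n,$$ where $Z_n(\beta,h)$ is the normalizing constant, and let $Y\in\{-1,1\}^n$ be obtained from $X$ by flipping the sign of each coordinate independently with probability $p$. Put $\overline{X_n}=\frac1n\sum_i X_i$, $\overline{Y_n}=\frac1n\sum_i Y_i$, $$m=\operatorname{sign}(\overline{X_n}-S),\qquad \hat m=\operatorname{sign}(\overline{Y_n}-(1-2p)S),\qquad P_e^{(n)}=\mathbb P(m\ne\hat m),$$ where $\operatorname{sign}(0)=0$. For $p>0$ let $D_p=\frac{1-2p}{\sqrt{4p(1-p)}}$; let $\operatorname{arccot}x=\frac{\pi}{2}-\arctan x$ and $\log 0=-\infty$. Let $H(x)=-x\log x-(1-x)\log(1-x)$ be the binary entropy function, and consider the maximizers over $\mu\in[-1,1]$ of $$\mu\mapsto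 h\mu+\tfrac12\beta\mu^2+H\big(\tfrac{1+\mu}{2}\big).$$ **Proposition (complete graph with Curie–Weiss prior).** 1. Suppose $h\ne0$ or $\beta\le1$. Then there is exactly one maximizer, denoted $\mu_{\beta,h}$, and it lies in $(-1,1)$. (a) If $S\ne\mu_{\beta,h}$, then $\lim_{n\to\infty}P_e^{(n)}=0$, and furthermore $\limsup_{n\to\infty}\frac1n\log P_e^{(n)}<0$. (b) If $S=\mu_{\beta,h}$, $p>0$ and $(\beta,h)\neq(1,0)$, then $$\lim_{n\to\infty}P_e^{(n)}=\frac1\pi\operatorname{arccot}(D_p\,\sigma_{\beta,h})>0,\qquad \sigma_{\beta,h}^2=\frac{1-\mu_{\beta,h}^2}{1-\beta+\beta\mu_{\beta,h}^2}.$$ At the critical point $(\beta,h)=(1,0)$, where the denominator of $\sigma^2_{\beta,h}$ vanishes ($\sigma_{\beta,h}=+\infty$), if $S=\mu_{1,0}$ then $\lim_{n\to\infty}P_e^{(n)}=0$. 2. Suppose $h=0$ and $\beta>1$. Then there are exactly two maximizers, $\pm\mu^+_{\beta,0}$ with $0<\mu^+_{\beta,0}<1$. (a) If $S\ne\pm\mu^+_{\beta,0}$,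 then $\lim_{n\to\infty}P_e^{(n)}=0$, and furthermore $\limsup_{n\to\infty}\frac1n\log P_e^{(n)}<0$. (b) If $S=\mu^+_{\beta,0}$ or $S=-\mu^+_{\beta,0}$, and $p>0$, then $$\lim_{n\to\infty}P_e^{(n)}=\frac1{2\pi}\operatorname{arccot}(D_p\,\sigma_{\beta,0})>0,\qquad \sigma_{\beta,0}^2=\frac{1-(\mu^+_{\beta,0})^2}{1-\beta+\beta(\mu^+_{\beta,0})^2}.$$ -/

import Mathlib

open Filter Topology Set

noncomputable section

namespace CurieWeiss

/-- The numerical value of a binary sentiment: `true` stands for `+1`, `false` for `-1`. -/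
def spin (b : Bool) : ℝ := if b then 1 else -1

/-- The sum `1ᵀx = x₁ + ⋯ + xₙ` of the sentiments of a configuration in `{-1, 1}ⁿ`. -/
def totalSpin {n : ℕ} (x : Fin n → Bool) : ℝ := ∑ i, spin (x i)

/-- The average of the sentiments of a configuration. -/
def avgSpin {n : ℕ} (x : Fin n → Bool) : ℝ := totalSpin x / n

/-- The unnormalized Curie–Weiss weight `exp ((β / (2n)) (1ᵀx)² + h 1ᵀx)`. -/
def weight {n : ℕ} (β h : ℝ) (x : Fin n → Bool) : ℝ :=
  Real.exp (β / (2 * n) * totalSpin x ^ 2 + h * totalSpin x)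

/-- The partition function. -/
def partitionFunction (n : ℕ) (β h : ℝ) : ℝ := ∑ x : Fin n → Bool, weight β h x

/-- The Curie–Weiss prior: the probability of `X = x`. -/
def prior {n : ℕ} (β h : ℝ) (x : Fin n → Bool) : ℝ := weight β h x / partitionFunction n β h

/-- The conditional probability of `Y = y` given `X = x`: each coordinate passes independently
through a binary symmetric channel with cross-over probability `p`. -/
def channel {n : ℕ} (p : ℝ) (x y : Fin n → Bool) : ℝ :=
  ∏ i, if y i = x i then 1 - p else p

/-- The supermajority sentiment `m = sign (X̄ - S)`. -/
def sentiment {n : ℕ} (S : ℝ) (x : Fin n → Bool) : SignType := SignType.sign (avgSpin x - S)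

/-- The naive detector `m̂ = sign (Ȳ - (1 - 2p) S)`. -/
def detector {n : ℕ} (p S : ℝ) (y : Fin n → Bool) : SignType :=
  SignType.sign (avgSpin y - (1 - 2 * p) * S)

/-- The detection error probability `ℙ (m ≠ m̂)` under the joint law of `(X, Y)`. -/
def errorProb (β h p S : ℝ) (n : ℕ) : ℝ :=
  ∑ x : Fin n → Bool, ∑ y : Fin n → Bool,
    if sentiment S x ≠ detector p S y then prior β h x * channel p x y else 0

/-- The exponential rate `limsup (1/n) log P_e⁽ⁿ⁾`, as an extended real number
(with `log 0 = -∞`). -/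
def errorRate (β h p S : ℝ) : EReal :=
  limsup (fun n : ℕ =>
    ((1 / (n : ℝ) : ℝ) : EReal) * ENNReal.log (ENNReal.ofReal (errorProb β h p S n))) atTop

/-- The function `h μ + β μ² / 2 + H ((1 + μ) / 2)` whose maximum over `[-1, 1]` is the free
entropy density; `H` is the binary entropy function (natural logarithm). -/
def entropyFunctional (β h μ : ℝ) : ℝ :=
  h * μ + 1 / 2 * β * μ ^ 2 + Real.binEntropy ((1 + μ) / 2)

/-- The set of maximizing values of `entropyFunctional β h` over `[-1, 1]`. -/
def maximizers (β h : ℝ) : Set ℝ :=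
  {μ | μ ∈ Icc (-1 : ℝ) 1 ∧ IsMaxOn (entropyFunctional β h) (Icc (-1) 1) μ}

/-- `σ = √((1 - μ²) / (1 - β + β μ²))`. -/
def sigma (β μ : ℝ) : ℝ := Real.sqrt ((1 - μ ^ 2) / (1 - β + β * μ ^ 2))

/-- `D_p = (1 - 2p) / √(4p(1 - p))`. -/
def channelD (p : ℝ) : ℝ := (1 - 2 * p) / Real.sqrt (4 * p * (1 - p))

/-- The inverse cotangent, with values in `(0, π)`. -/
def arccot (x : ℝ) : ℝ := Real.pi / 2 - Real.arctan x

end CurieWeiss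

end

open Filter Topology Set MeasureTheory ProbabilityTheory

namespace CurieWeiss

/-! Completing a Gaussian square in the Curie–Weiss weight (the Hubbard–Stratonovich transformation)
turns the prior into a mixture over real z of product laws with mean `tanh (β z + h)`, the mixing
density being proportional to `exp (n * freeEnergy β h z)`. The error probability is thus a ratio of
two one-dimensional integrals (`errorProb_eq_div`), the numerator carrying the extra factor
`iidError`, the error for independent spins. By the Gibbs variational inequality `freeEnergy`
dominates `entropyFunctional`, with equality where `tanh (β μ + h) = μ`, so the maximizers agree
(`maximizers_eq`); they are located through the concavity of tanh on the positive half-line.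

Let z₀ be the point whose product law has mean S. Away from z₀ a Chernoff bound makes `iidError`
exponentially small (`iidError_le`); near z₀ the mixing density itself is exponentially small unless
z₀ maximizes the free energy. This is the off-maximizer case (`exists_errorProb_le`).

If S = μ is a nondegenerate maximizer, put z = μ + u/√n. Laplace's method (`tendsto_laplace`) makes
u Gaussian with precision κ = β(1 - β(1 - μ²)). Given u, the central limit theorem
(`tendsto_iidError`) makes the spin fluctuation Gaussian with mean β(1 - μ²)u and variance 1 - μ²,
with an independent channel noise of variance 4p(1 - p). Averaging over u yields total variance σ²
for the signal (`integral_gaussian_mismatch`), and the probability that two correlated centred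
Gaussians differ in sign is an angle over 2π (`gaussian_mismatch`). With two symmetric phases, each
has half of the mass and only one sits at the threshold, whence the factor 1/2.

At the critical point the free energy is flatter than quadratic, so the mixing law lives on a scale
larger than 1/√n, where the Chernoff bound already forces the error to vanish
(`tendsto_errorProb_critical`). -/

/-! ### Gibbs variational principle and the free energy -/

theorem hasDerivAt_tanh (x : ℝ) : HasDerivAt Real.tanh (1 - Real.tanh x ^ 2) x := by
  have h := (Real.hasDerivAt_sinh x).div (Real.hasDerivAt_cosh x) (Real.cosh_pos x).ne'
  have hf : (fun y => Real.sinh y / Real.cosh y) = Real.tanh := by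
    ext y; rw [Real.tanh_eq_sinh_div_cosh]
  have hd : (Real.sinh / Real.cosh : ℝ → ℝ) = Real.tanh := hf
  rw [hd] at h
  refine h.congr_deriv ?_
  rw [Real.tanh_eq_sinh_div_cosh]
  field_simp [(Real.cosh_pos x).ne']

theorem tanh_strictMono : StrictMono Real.tanh :=
  strictMono_of_deriv_pos fun x => by
    rw [(hasDerivAt_tanh x).deriv]
    linarith [Real.tanh_sq_lt_one x]

theorem continuous_tanh : Continuous Real.tanh :=
  continuous_iff_continuousAt.2 fun x => (hasDerivAt_tanh x).continuousAt

theorem one_add_tanh_div_two (a : ℝ) :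
    (1 + Real.tanh a) / 2 = Real.exp a / (2 * Real.cosh a) := by
  have := Real.cosh_pos a
  rw [Real.tanh_eq_sinh_div_cosh, ← Real.cosh_add_sinh]
  field_simp

theorem one_sub_tanh_div_two (a : ℝ) :
    (1 - Real.tanh a) / 2 = Real.exp (-a) / (2 * Real.cosh a) := by
  simpa [sub_eq_add_neg] using one_add_tanh_div_two (-a)

/-- The Gibbs variational inequality for a single spin. -/
theorem mul_add_binEntropy_le (a : ℝ) {μ : ℝ} (hμ : μ ∈ Icc (-1 : ℝ) 1) :
    a * μ + Real.binEntropy ((1 + μ) / 2) ≤ Real.log (2 * Real.cosh a) := by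
  have hc : 0 < 2 * Real.cosh a := by linarith [Real.cosh_pos a]
  -- Apply `log t ≤ t - 1` to t = e^b / (2 cosh a · q). Summed over the two outcomes of a spin, this
  -- is nonnegativity of relative entropy.
  have key : ∀ q b : ℝ, 0 ≤ q →
      q * (b - Real.log (2 * Real.cosh a) + Real.log q⁻¹) ≤
        Real.exp b / (2 * Real.cosh a) - q := by
    intro q b hq
    rcases hq.eq_or_lt with rfl | hq
    · simp only [zero_mul, sub_zero]; positivity
    · have h1 : b - Real.log (2 * Real.cosh a) + Real.log q⁻¹ =
          Real.log (Real.exp b / (2 * Real.cosh a) * q⁻¹) := by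
        rw [Real.log_mul (x := Real.exp b / (2 * Real.cosh a)) (by positivity) (by positivity),
          Real.log_div (by positivity) (by positivity), Real.log_exp]
      rw [h1]
      have h2 := Real.log_le_sub_one_of_pos
        (show 0 < Real.exp b / (2 * Real.cosh a) * q⁻¹ by positivity)
      calc _ ≤ q * (Real.exp b / (2 * Real.cosh a) * q⁻¹ - 1) := by gcongr
        _ = _ := by field_simp
  have h1 := key ((1 + μ) / 2) a (by linarith [hμ.1])
  have h2 := key (1 - (1 + μ) / 2) (-a) (by linarith [hμ.2])
  have h3 : Real.exp a / (2 * Real.cosh a) + Real.exp (-a) / (2 * Real.cosh a) = 1 := by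
    rw [← one_add_tanh_div_two, ← one_sub_tanh_div_two]; ring
  rw [Real.binEntropy]
  nlinarith

/-- The equality case: relative entropy vanishes when the spin has the tilted law itself, whose mean
is `tanh a`. -/
theorem mul_tanh_add_binEntropy (a : ℝ) :
    a * Real.tanh a + Real.binEntropy ((1 + Real.tanh a) / 2) = Real.log (2 * Real.cosh a) := by
  have hc : 0 < 2 * Real.cosh a := by linarith [Real.cosh_pos a]
  have h1 : 1 - (1 + Real.tanh a) / 2 = (1 - Real.tanh a) / 2 := by ring
  rw [Real.binEntropy, h1, Real.log_inv, Real.log_inv]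
  have h2 : Real.log ((1 + Real.tanh a) / 2) = a - Real.log (2 * Real.cosh a) := by
    rw [one_add_tanh_div_two, Real.log_div (by positivity) hc.ne', Real.log_exp]
  have h3 : Real.log ((1 - Real.tanh a) / 2) = -a - Real.log (2 * Real.cosh a) := by
    rw [one_sub_tanh_div_two, Real.log_div (by positivity) hc.ne', Real.log_exp]
  rw [h2, h3]; ring

/-- The free energy after a Hubbard–Stratonovich transformation. -/
noncomputable def freeEnergy (β h z : ℝ) : ℝ :=
  Real.log (2 * Real.cosh (β * z + h)) - β * z ^ 2 / 2

/-- Gibbs at the field a = β μ + h: removing β μ²/2 from a μ leaves exactly the energy h μ + β μ²/2.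
-/
theorem entropyFunctional_le_freeEnergy (β h : ℝ) {μ : ℝ} (hμ : μ ∈ Icc (-1 : ℝ) 1) :
    entropyFunctional β h μ ≤ freeEnergy β h μ := by
  have := mul_add_binEntropy_le (β * μ + h) hμ
  simp only [entropyFunctional, freeEnergy]
  nlinarith

theorem entropyFunctional_eq_freeEnergy {β h μ : ℝ} (hμ : Real.tanh (β * μ + h) = μ) :
    entropyFunctional β h μ = freeEnergy β h μ := by
  have := mul_tanh_add_binEntropy (β * μ + h)
  rw [hμ] at this
  simp only [entropyFunctional, freeEnergy]
  nlinarith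

/-- The maximizers of the entropy functional are those of the free energy. -/
theorem maximizers_eq {β h : ℝ} {M : Set ℝ} (hM : M.Nonempty)
    (hfix : ∀ μ ∈ M, Real.tanh (β * μ + h) = μ)
    (hmax : ∀ μ ∈ M, ∀ z, freeEnergy β h z ≤ freeEnergy β h μ)
    (hlt : ∀ μ ∈ M, ∀ z, z ∉ M → freeEnergy β h z < freeEnergy β h μ) :
    maximizers β h = M := by
  have hI : ∀ μ ∈ M, μ ∈ Icc (-1 : ℝ) 1 := fun μ hμ => by
    rw [← hfix μ hμ]
    exact ⟨(Real.neg_one_lt_tanh _).le, (Real.tanh_lt_one _).le⟩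
  ext ν
  constructor
  · rintro ⟨hν, hνmax⟩
    -- A maximizer ν outside M would have entropy functional at most its free energy, hence strictly
    -- below the common value of both functionals at μ.
    by_contra hνM
    obtain ⟨μ, hμ⟩ := hM
    have h1 : entropyFunctional β h μ ≤ entropyFunctional β h ν := hνmax (hI μ hμ)
    rw [entropyFunctional_eq_freeEnergy (hfix μ hμ)] at h1
    linarith [entropyFunctional_le_freeEnergy β h hν, hlt μ hμ ν hνM]
  · intro hν
    refine ⟨hI ν hν, fun z hz => ?_⟩
    change entropyFunctional β h z ≤ entropyFunctional β h ν
    rw [entropyFunctional_eq_freeEnergy (hfix ν hν)]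
    exact (entropyFunctional_le_freeEnergy β h hz).trans (hmax ν hν z)

/-! ### Location of the maximizers of the free energy -/

theorem hasDerivAt_freeEnergy (β h z : ℝ) :
    HasDerivAt (freeEnergy β h) (β * (Real.tanh (β * z + h) - z)) z := by
  have h0 : HasDerivAt (fun z : ℝ => β * z + h) β z := by
    simpa using ((hasDerivAt_id z).const_mul β).add_const h
  have hc := Real.cosh_pos (β * z + h)
  have h1 := (((Real.hasDerivAt_cosh _).comp z h0).const_mul 2).log (by simpa using hc.ne')
  have h2 := h1.sub ((((hasDerivAt_id z).pow 2).const_mul β).div_const 2)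
  refine h2.congr_deriv ?_
  simp only [Real.tanh_eq_sinh_div_cosh, Function.comp, id]
  field_simp
  norm_num
  ring

theorem continuous_freeEnergy (β h : ℝ) : Continuous (freeEnergy β h) :=
  continuous_iff_continuousAt.2 fun z => (hasDerivAt_freeEnergy β h z).continuousAt

theorem freeEnergy_neg (β h z : ℝ) : freeEnergy β h (-z) = freeEnergy β (-h) z := by
  simp only [freeEnergy]
  rw [show β * -z + h = -(β * z + -h) by ring, Real.cosh_neg]; ring

/-- The quadratic term is even, and a positive field makes |β z + h| < |-β z + h| for negative z.
Maximization thereby reduces to the nonnegative half-line. -/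
theorem freeEnergy_lt_freeEnergy_neg {β h z : ℝ} (hβ : 0 < β) (hh : 0 < h) (hz : z < 0) :
    freeEnergy β h z < freeEnergy β h (-z) := by
  simp only [freeEnergy]
  have : Real.cosh (β * z + h) < Real.cosh (β * -z + h) := by
    rw [Real.cosh_lt_cosh, abs_lt, abs_of_pos (by nlinarith)]
    constructor <;> nlinarith
  have := Real.log_lt_log (by linarith [Real.cosh_pos (β * z + h)])
    (mul_lt_mul_of_pos_left this two_pos)
  linarith

theorem hasDerivAt_tanh_sub (β h z : ℝ) :
    HasDerivAt (fun z => Real.tanh (β * z + h) - z)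
      (β * (1 - Real.tanh (β * z + h) ^ 2) - 1) z := by
  have h0 : HasDerivAt (fun z : ℝ => β * z + h) β z := by
    simpa using ((hasDerivAt_id z).const_mul β).add_const h
  exact (((hasDerivAt_tanh _).comp z h0).sub (hasDerivAt_id z)).congr_deriv (by ring)

theorem strictAntiOn_deriv_tanh_sub {β h : ℝ} (hβ : 0 < β) (hh : 0 ≤ h) :
    StrictAntiOn (fun z => β * (1 - Real.tanh (β * z + h) ^ 2) - 1) (Ici 0) := by
  intro x hx y _ hxy
  have h1 : Real.tanh (β * x + h) < Real.tanh (β * y + h) := tanh_strictMono (by nlinarith)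
  have h2 : 0 ≤ Real.tanh (β * x + h) := by
    rw [← Real.tanh_zero]
    exact tanh_strictMono.monotone (by have := mem_Ici.1 hx; positivity)
  have : Real.tanh (β * x + h) ^ 2 < Real.tanh (β * y + h) ^ 2 := by gcongr
  change β * (1 - Real.tanh (β * y + h) ^ 2) - 1 < β * (1 - Real.tanh (β * x + h) ^ 2) - 1
  nlinarith

/-- For z, h ≥ 0 the argument of tanh stays where tanh is concave. This is what makes the sign
change of the derivative in `exists_max_nonneg` unique. -/
theorem strictConcaveOn_tanh_sub {β h : ℝ} (hβ : 0 < β) (hh : 0 ≤ h) :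
    StrictConcaveOn ℝ (Ici 0) (fun z => Real.tanh (β * z + h) - z) := by
  refine StrictAntiOn.strictConcaveOn_of_deriv (convex_Ici 0)
    (fun z _ => (hasDerivAt_tanh_sub β h z).continuousAt.continuousWithinAt) ?_
  rw [interior_Ici]
  have : deriv (fun z => Real.tanh (β * z + h) - z) =
      fun z => β * (1 - Real.tanh (β * z + h) ^ 2) - 1 :=
    funext fun z => (hasDerivAt_tanh_sub β h z).deriv
  rw [this]
  exact (strictAntiOn_deriv_tanh_sub hβ hh).mono Ioi_subset_Ici_self

/-- With a field the value at 0 is already tanh h > 0; without one, the slope at 0 is β - 1 > 0. -/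
theorem exists_tanh_sub_pos {β h : ℝ} (hh : 0 ≤ h) (hor : 0 < h ∨ 1 < β) :
    ∃ z ∈ Ioo (0 : ℝ) 1, 0 < Real.tanh (β * z + h) - z := by
  have h1 : ∀ᶠ z : ℝ in 𝓝[>] 0, z ∈ Ioo (0 : ℝ) 1 := Ioo_mem_nhdsGT one_pos
  suffices ∀ᶠ z : ℝ in 𝓝[>] 0, 0 < Real.tanh (β * z + h) - z from (h1.and this).exists
  have hd := hasDerivAt_tanh_sub β h 0
  rcases hh.eq_or_lt with rfl | hh
  · have hβ : 1 < β := hor.resolve_left (lt_irrefl _)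
    have := (hasDerivAt_iff_tendsto_slope.1 hd).mono_left
      (nhdsWithin_mono 0 (fun x (hx : 0 < x) => hx.ne'))
    have := this.eventually (lt_mem_nhds (a := 0) (by simpa using hβ))
    filter_upwards [this, h1] with z hz hz1
    rw [slope_def_field] at hz
    simp only [mul_zero, add_zero, Real.tanh_zero, sub_zero] at hz
    have := mul_pos hz hz1.1
    rw [div_mul_cancel₀ _ hz1.1.ne'] at this
    rwa [add_zero]
  · refine eventually_nhdsWithin_of_eventually_nhds
      (hd.continuousAt.eventually (lt_mem_nhds (a := 0) ?_))
    have : Real.tanh 0 < Real.tanh h := tanh_strictMono hh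
    simpa using this

/-- On the nonnegative half-line, the free energy has a unique nondegenerate maximizer. -/
theorem exists_max_nonneg {β h : ℝ} (hβ : 0 < β) (hh : 0 ≤ h) (hor : 0 < h ∨ 1 < β) :
    ∃ μ ∈ Ioo (0 : ℝ) 1, Real.tanh (β * μ + h) = μ ∧ β * (1 - μ ^ 2) < 1 ∧
      ∀ z, 0 ≤ z → z ≠ μ → freeEnergy β h z < freeEnergy β h μ := by
  obtain ⟨z₀, hz₀, hpos⟩ := exists_tanh_sub_pos hh hor
  set g : ℝ → ℝ := fun z => Real.tanh (β * z + h) - z with hg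
  have hgc : Continuous g :=
    continuous_iff_continuousAt.2 fun z => (hasDerivAt_tanh_sub β h z).continuousAt
  have hg1 : g 1 < 0 := by linarith [Real.tanh_lt_one (β * 1 + h), show g 1 = _ from rfl]
  have hg0 : 0 ≤ g 0 := by
    have : Real.tanh 0 ≤ Real.tanh h := tanh_strictMono.monotone hh
    simpa [hg] using this
  obtain ⟨μ, hμ, hgμ⟩ := intermediate_value_Icc' hz₀.2.le hgc.continuousOn ⟨hg1.le, hpos.le⟩
  have hμ0 : 0 < μ := hz₀.1.trans_le hμ.1
  have hμ1 : μ < 1 := lt_of_le_of_ne hμ.2 (by rintro rfl; linarith)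
  have hfix : Real.tanh (β * μ + h) = μ := by simp only [hg] at hgμ; linarith
  have hcc := strictConcaveOn_tanh_sub (h := h) hβ hh
  -- A chord argument: z lies strictly between 0 and μ, with g 0 ≥ 0 and g μ = 0, and a strictly
  -- concave function exceeds its chord. The same comparison with μ between 0 and z gives negativity
  -- beyond μ.
  have hleft : ∀ z ∈ Ioo 0 μ, 0 < g z := by
    intro z hz
    have := hcc.2 self_mem_Ici (mem_Ici.2 hμ0.le) hμ0.ne
      (show 0 < 1 - z / μ by rw [sub_pos, div_lt_one hμ0]; exact hz.2)
      (div_pos hz.1 hμ0) (by ring)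
    simp only [smul_eq_mul] at this
    rw [show (1 - z / μ) * 0 + z / μ * μ = z by field_simp; ring] at this
    change (1 - z / μ) * g 0 + z / μ * g μ < g z at this
    rw [hgμ, mul_zero, add_zero] at this
    exact lt_of_le_of_lt (mul_nonneg (by rw [sub_nonneg, div_le_one hμ0]; exact hz.2.le) hg0) this
  have hright : ∀ z ∈ Ioi μ, g z < 0 := by
    intro z (hz : μ < z)
    have hz0 := hμ0.trans hz
    have := hcc.2 self_mem_Ici (mem_Ici.2 hz0.le) hz0.ne
      (show 0 < 1 - μ / z by rw [sub_pos, div_lt_one hz0]; exact hz)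
      (div_pos hμ0 hz0) (by ring)
    simp only [smul_eq_mul] at this
    rw [show (1 - μ / z) * 0 + μ / z * z = μ by field_simp; ring] at this
    change (1 - μ / z) * g 0 + μ / z * g z < g μ at this
    have h1 : 0 ≤ (1 - μ / z) * g 0 :=
      mul_nonneg (by rw [sub_nonneg, div_le_one hz0]; exact hz.le) hg0
    have h2 : μ / z * g z < 0 := by linarith
    exact (pos_iff_neg_of_mul_neg h2).1 (div_pos hμ0 hz0)
  refine ⟨μ, ⟨hμ0, hμ1⟩, hfix, ?_, ?_⟩
  -- Nondegeneracy: the mean slope of g on [0, μ] is nonpositive, so g' ≤ 0 at some c < μ, and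
  -- strict decrease of g' gives g' μ < 0.
  · obtain ⟨c, hc, hcd⟩ := exists_hasDerivAt_eq_slope g _ hμ0 hgc.continuousOn
      (fun z _ => hasDerivAt_tanh_sub β h z)
    have h1 := strictAntiOn_deriv_tanh_sub hβ hh (show c ∈ Ici (0 : ℝ) from hc.1.le)
      (show μ ∈ Ici (0 : ℝ) from hμ0.le) hc.2
    have h2 : (g μ - g 0) / (μ - 0) ≤ 0 :=
      div_nonpos_of_nonpos_of_nonneg (by linarith) (by linarith)
    simp only [hfix] at h1
    linarith
  · intro z hz hzμ
    have hd : deriv (freeEnergy β h) = fun z => β * g z :=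
      funext fun z => (hasDerivAt_freeEnergy β h z).deriv
    rcases hzμ.lt_or_gt with hlt | hlt
    · refine strictMonoOn_of_deriv_pos (convex_Icc 0 μ) (continuous_freeEnergy β h).continuousOn
        ?_ ⟨hz, hlt.le⟩ ⟨hμ0.le, le_rfl⟩ hlt
      rw [interior_Icc, hd]
      exact fun x hx => mul_pos hβ (hleft x hx)
    · refine strictAntiOn_of_deriv_neg (convex_Ici μ) (continuous_freeEnergy β h).continuousOn
        ?_ self_mem_Ici hlt.le hlt
      rw [interior_Ici, hd]
      exact fun x hx => mul_neg_of_pos_of_neg hβ (hright x hx)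

/-- Without field and at high temperature, the free energy has its unique maximum at `0`. -/
theorem freeEnergy_lt_zero_field {β z : ℝ} (hβ : 0 < β) (hβ1 : β ≤ 1) (hz : z ≠ 0) :
    freeEnergy β 0 z < freeEnergy β 0 0 := by
  wlog hpos : 0 < z generalizing z
  · have := this (neg_ne_zero.2 hz) (by rcases hz.lt_or_gt with h | h <;> linarith)
    rwa [freeEnergy_neg, neg_zero] at this
  have hd : deriv (freeEnergy β 0) = fun z => β * (Real.tanh (β * z + 0) - z) :=
    funext fun z => (hasDerivAt_freeEnergy β 0 z).deriv
  refine strictAntiOn_of_deriv_neg (convex_Ici 0) (continuous_freeEnergy β 0).continuousOn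
        ?_ self_mem_Ici hpos.le hpos
  rw [interior_Ici, hd]
  intro x (hx : 0 < x)
  refine mul_neg_of_pos_of_neg hβ ?_
  have hcc := strictAntiOn_deriv_tanh_sub hβ (le_refl 0)
  obtain ⟨c, hc, hcd⟩ := exists_hasDerivAt_eq_slope (fun z => Real.tanh (β * z + 0) - z) _ hx
    (fun z _ => (hasDerivAt_tanh_sub β 0 z).continuousAt.continuousWithinAt)
    (fun z _ => hasDerivAt_tanh_sub β 0 z)
  -- The slope of tanh(β z) - z at 0 is β - 1 ≤ 0, and slopes decrease strictly to the right, so the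
  -- function is negative there.
  have h1 := hcc (self_mem_Ici) (show c ∈ Ici (0 : ℝ) from hc.1.le) hc.1
  simp only [mul_zero, add_zero, Real.tanh_zero, sub_zero] at h1 hcd
  have h2 : (Real.tanh (β * x) - x) / x < 0 := by rw [← hcd]; nlinarith
  rw [add_zero]
  exact (div_neg_iff.1 h2).elim (fun h => absurd h.2 hx.not_gt) (fun h => h.1)

/-- A unique maximizer in nonzero field or at high temperature. -/
theorem exists_unique_max {β h : ℝ} (hβ : 0 < β) (hor : h ≠ 0 ∨ β ≤ 1) :
    ∃ μ ∈ Ioo (-1 : ℝ) 1, Real.tanh (β * μ + h) = μ ∧ (h = 0 → μ = 0) ∧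
      (¬ (h = 0 ∧ β = 1) → β * (1 - μ ^ 2) < 1) ∧
      ∀ z, z ≠ μ → freeEnergy β h z < freeEnergy β h μ := by
  have hpos : ∀ h : ℝ, 0 < h → ∃ μ ∈ Ioo (0 : ℝ) 1, Real.tanh (β * μ + h) = μ ∧
      β * (1 - μ ^ 2) < 1 ∧ ∀ z, z ≠ μ → freeEnergy β h z < freeEnergy β h μ := by
    intro h hh
    obtain ⟨μ, hμ, hfix, hnd, hmax⟩ := exists_max_nonneg hβ hh.le (Or.inl hh)
    refine ⟨μ, hμ, hfix, hnd, fun z hz => ?_⟩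
    rcases le_or_gt 0 z with hz0 | hz0
    · exact hmax z hz0 hz
    · refine (freeEnergy_lt_freeEnergy_neg hβ hh hz0).trans_le ?_
      by_cases hzm : -z = μ
      · rw [hzm]
      · exact (hmax _ (by linarith) hzm).le
  rcases lt_trichotomy h 0 with hh | rfl | hh
  · obtain ⟨μ, hμ, hfix, hnd, hmax⟩ := hpos (-h) (by linarith)
    refine ⟨-μ, ⟨by linarith [hμ.2], by linarith [hμ.1]⟩, ?_, fun h0 => absurd h0 hh.ne,
      fun _ => by simpa using hnd, fun z hz => ?_⟩
    · rw [show β * -μ + h = -(β * μ + -h) by ring, Real.tanh_neg, hfix]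
    · have := hmax (-z) (fun h0 => hz (by linarith))
      rwa [freeEnergy_neg, neg_neg, ← neg_neg μ, freeEnergy_neg, neg_neg] at this
  · have hβ1 : β ≤ 1 := hor.resolve_left (by simp)
    refine ⟨0, by norm_num, by simp, fun _ => rfl, fun hne => ?_,
      fun z hz => freeEnergy_lt_zero_field hβ hβ1 hz⟩
    have : β ≠ 1 := fun h1 => hne ⟨rfl, h1⟩
    simpa using lt_of_le_of_ne hβ1 this
  · obtain ⟨μ, hμ, hfix, hnd, hmax⟩ := hpos h hh
    exact ⟨μ, ⟨by linarith [hμ.1], hμ.2⟩, hfix, fun h0 => absurd h0 hh.ne', fun _ => hnd, hmax⟩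

/-! ### Mixture representation of the Curie–Weiss law -/

/-- The law of `n` independent spins with mean `m`. -/
noncomputable def bernWeight {n : ℕ} (m : ℝ) (x : Fin n → Bool) : ℝ :=
  ∏ i, (1 + m * spin (x i)) / 2

/-- The detection error probability when the spins are independent with mean `m`. -/
noncomputable def iidError (p S : ℝ) (n : ℕ) (m : ℝ) : ℝ :=
  ∑ x : Fin n → Bool, ∑ y : Fin n → Bool,
    if sentiment S x ≠ detector p S y then bernWeight m x * channel p x y else 0

/-- Sums of products over pairs of configurations factorize. -/
theorem sum_sum_prod {R : Type*} [CommSemiring R] (n : ℕ) (f : Bool → Bool → R) :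
    ∑ x : Fin n → Bool, ∑ y : Fin n → Bool, ∏ i, f (x i) (y i) = (∑ a, ∑ b, f a b) ^ n := by
  have h1 : ∀ x : Fin n → Bool, ∑ y : Fin n → Bool, ∏ i, f (x i) (y i) =
      ∏ i, ∑ b, f (x i) b := fun x => by
    rw [Finset.prod_univ_sum, Fintype.piFinset_univ]
  simp_rw [h1]
  have h2 := Finset.prod_univ_sum (fun _ : Fin n => (Finset.univ : Finset Bool))
    (fun _ a => ∑ b, f a b)
  simp only [Fintype.piFinset_univ] at h2
  rw [← h2]; simp

theorem bernWeight_mul_channel {n : ℕ} (m p : ℝ) (x y : Fin n → Bool) :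
    bernWeight m x * channel p x y =
      ∏ i, ((1 + m * spin (x i)) / 2 * if y i = x i then 1 - p else p) := by
  rw [bernWeight, channel, Finset.prod_mul_distrib]

theorem sum_channel {n : ℕ} (p : ℝ) (x : Fin n → Bool) :
    ∑ y : Fin n → Bool, channel p x y = 1 := by
  have h2 := Finset.prod_univ_sum (fun _ : Fin n => (Finset.univ : Finset Bool))
    (fun i b => if b = x i then 1 - p else p)
  simp only [Fintype.piFinset_univ] at h2
  simp only [channel]
  rw [← h2]
  refine Finset.prod_eq_one fun i _ => ?_
  cases x i <;> simp

theorem sum_bernWeight (n : ℕ) (m : ℝ) : ∑ x : Fin n → Bool, bernWeight m x = 1 := by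
  have h2 := Finset.prod_univ_sum (fun _ : Fin n => (Finset.univ : Finset Bool))
    (fun _ b => (1 + m * spin b) / 2)
  simp only [Fintype.piFinset_univ] at h2
  simp only [bernWeight]
  rw [← h2]
  refine Finset.prod_eq_one fun i _ => ?_
  simp [spin]; ring

theorem channel_nonneg {n : ℕ} {p : ℝ} (hp0 : 0 ≤ p) (hp1 : p ≤ 1) (x y : Fin n → Bool) :
    0 ≤ channel p x y :=
  Finset.prod_nonneg fun i _ => by split_ifs <;> linarith

theorem bernWeight_nonneg {n : ℕ} {m : ℝ} (hm : m ∈ Icc (-1 : ℝ) 1) (x : Fin n → Bool) :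
    0 ≤ bernWeight m x :=
  Finset.prod_nonneg fun i _ => by
    rw [spin]; split_ifs <;> linarith [hm.1, hm.2]

theorem iidError_nonneg {p m : ℝ} (hp0 : 0 ≤ p) (hp1 : p ≤ 1) (S : ℝ) (n : ℕ)
    (hm : m ∈ Icc (-1 : ℝ) 1) : 0 ≤ iidError p S n m :=
  Finset.sum_nonneg fun x _ => Finset.sum_nonneg fun y _ => by
    split_ifs
    · exact mul_nonneg (bernWeight_nonneg hm x) (channel_nonneg hp0 hp1 x y)
    · exact le_rfl

theorem sum_sum_bernWeight_mul_channel (n : ℕ) (m p : ℝ) :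
    ∑ x : Fin n → Bool, ∑ y : Fin n → Bool, bernWeight m x * channel p x y = 1 := by
  simp_rw [← Finset.mul_sum, sum_channel, mul_one]
  exact sum_bernWeight n m

theorem iidError_le_one {p m : ℝ} (hp0 : 0 ≤ p) (hp1 : p ≤ 1) (S : ℝ) (n : ℕ)
    (hm : m ∈ Icc (-1 : ℝ) 1) : iidError p S n m ≤ 1 := by
  rw [← sum_sum_bernWeight_mul_channel n m p]
  refine Finset.sum_le_sum fun x _ => Finset.sum_le_sum fun y _ => ?_
  split_ifs
  · exact le_rfl
  · exact mul_nonneg (bernWeight_nonneg hm x) (channel_nonneg hp0 hp1 x y)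

theorem continuous_bernWeight {n : ℕ} (x : Fin n → Bool) :
    Continuous fun m => bernWeight m x := by
  unfold bernWeight; fun_prop

theorem continuous_iidError (p S : ℝ) (n : ℕ) : Continuous (iidError p S n) := by
  refine continuous_finsetSum _ fun x _ => continuous_finsetSum _ fun y _ => ?_
  split_ifs
  · exact (continuous_bernWeight x).mul continuous_const
  · exact continuous_const

theorem tanh_mem_Icc (a : ℝ) : Real.tanh a ∈ Icc (-1 : ℝ) 1 :=
  ⟨(Real.neg_one_lt_tanh a).le, (Real.tanh_lt_one a).le⟩

theorem bernWeight_tanh {n : ℕ} (a : ℝ) (x : Fin n → Bool) :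
    bernWeight (Real.tanh a) x = Real.exp (a * totalSpin x) / (2 * Real.cosh a) ^ n := by
  have : ∀ b, (1 + Real.tanh a * spin b) / 2 = Real.exp (a * spin b) / (2 * Real.cosh a) := by
    intro b
    cases b
    · simpa [spin, sub_eq_add_neg] using one_sub_tanh_div_two a
    · simpa [spin] using one_add_tanh_div_two a
  simp only [bernWeight, this, totalSpin, Finset.mul_sum, Real.exp_sum]
  rw [Finset.prod_div_distrib]; simp

/-- The powers of 2 cosh cancel, and with T the total spin, β z T - n β z²/2 = β T²/(2n) - (β n/2)(z
- T/n)². Integrating over z then produces a Gaussian constant that does not depend on the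
configuration. -/
theorem exp_freeEnergy_mul_bernWeight {n : ℕ} (hn : n ≠ 0) (β h z : ℝ) (x : Fin n → Bool) :
    Real.exp (n * freeEnergy β h z) * bernWeight (Real.tanh (β * z + h)) x =
      weight β h x * Real.exp (-(β * n / 2) * (z - totalSpin x / n) ^ 2) := by
  have hn' : (n : ℝ) ≠ 0 := Nat.cast_ne_zero.2 hn
  have hc : 0 < 2 * Real.cosh (β * z + h) := by linarith [Real.cosh_pos (β * z + h)]
  have h1 : Real.exp (n * freeEnergy β h z) =
      (2 * Real.cosh (β * z + h)) ^ n * Real.exp (-(n * (β * z ^ 2 / 2))) := by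
    rw [freeEnergy, mul_sub, sub_eq_add_neg, Real.exp_add, Real.exp_nat_mul, Real.exp_log hc]
  rw [h1, bernWeight_tanh, weight, mul_right_comm, mul_div_cancel₀ _ (pow_ne_zero n hc.ne'),
    ← Real.exp_add, ← Real.exp_add]
  congr 1
  field_simp
  ring

theorem integral_exp_neg_mul_sub_sq (b c : ℝ) :
    ∫ z : ℝ, Real.exp (-b * (z - c) ^ 2) = √(Real.pi / b) := by
  rw [integral_sub_right_eq_self (fun z => Real.exp (-b * z ^ 2)) c, integral_gaussian]

theorem integrable_exp_freeEnergy_mul_bernWeight {n : ℕ} (hn : n ≠ 0) {β : ℝ} (hβ : 0 < β) (h : ℝ)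
    (x : Fin n → Bool) :
    Integrable fun z =>
      Real.exp (n * freeEnergy β h z) * bernWeight (Real.tanh (β * z + h)) x := by
  have hn' : 0 < (n : ℝ) := Nat.cast_pos.2 (Nat.pos_of_ne_zero hn)
  simp_rw [exp_freeEnergy_mul_bernWeight hn]
  exact ((integrable_exp_neg_mul_sq (by positivity)).comp_sub_right _).const_mul _

theorem integral_exp_freeEnergy_mul_bernWeight {n : ℕ} (hn : n ≠ 0) (β h : ℝ)
    (x : Fin n → Bool) :
    ∫ z, Real.exp (n * freeEnergy β h z) * bernWeight (Real.tanh (β * z + h)) x =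
      weight β h x * √(Real.pi / (β * n / 2)) := by
  simp_rw [exp_freeEnergy_mul_bernWeight hn]
  rw [integral_const_mul, integral_exp_neg_mul_sub_sq]

theorem exp_freeEnergy_eq_sum (n : ℕ) (β h z : ℝ) :
    Real.exp (n * freeEnergy β h z) = ∑ x : Fin n → Bool,
      Real.exp (n * freeEnergy β h z) * bernWeight (Real.tanh (β * z + h)) x := by
  rw [← Finset.mul_sum, sum_bernWeight, mul_one]

/-- The shift c cancels in the ratio of integrals; taking it to be the free energy at a reference
point keeps the exponents comparable for Laplace's method. -/
theorem exp_sub_eq (n : ℕ) (β h c z : ℝ) : Real.exp (n * (freeEnergy β h z - c)) =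
    Real.exp (-(n * c)) * Real.exp (n * freeEnergy β h z) := by
  rw [← Real.exp_add]; ring_nf

theorem integrable_exp_freeEnergy {n : ℕ} (hn : n ≠ 0) {β : ℝ} (hβ : 0 < β) (h c : ℝ) :
    Integrable fun z => Real.exp (n * (freeEnergy β h z - c)) := by
  simp_rw [exp_sub_eq]
  refine Integrable.const_mul ?_ _
  rw [funext (exp_freeEnergy_eq_sum n β h)]
  exact integrable_finsetSum _ fun x _ => integrable_exp_freeEnergy_mul_bernWeight hn hβ h x

theorem integral_exp_freeEnergy_pos {n : ℕ} (hn : n ≠ 0) {β : ℝ} (hβ : 0 < β) (h c : ℝ) :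
    0 < ∫ z, Real.exp (n * (freeEnergy β h z - c)) :=
  integral_exp_pos (integrable_exp_freeEnergy hn hβ h c)

theorem integral_exp_freeEnergy_mul_iidError {n : ℕ} (hn : n ≠ 0) {β : ℝ} (hβ : 0 < β)
    (h p S : ℝ) :
    ∫ z, Real.exp (n * freeEnergy β h z) * iidError p S n (Real.tanh (β * z + h)) =
      errorProb β h p S n * ∫ z, Real.exp (n * freeEnergy β h z) := by
  have hint := integrable_exp_freeEnergy_mul_bernWeight hn hβ h
  have hden : ∫ z, Real.exp (n * freeEnergy β h z) =
      partitionFunction n β h * √(Real.pi / (β * n / 2)) := by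
    rw [integral_congr_ae (ae_of_all _ (exp_freeEnergy_eq_sum n β h))]
    rw [integral_finsetSum _ fun x _ => hint x]
    simp_rw [integral_exp_freeEnergy_mul_bernWeight hn, ← Finset.sum_mul]
    rfl
  have hZ : 0 < partitionFunction n β h :=
    Finset.sum_pos (fun x _ => Real.exp_pos _) Finset.univ_nonempty
  have hterm : ∀ (x y : Fin n → Bool) (z : ℝ), Real.exp (n * freeEnergy β h z) *
      (if sentiment S x ≠ detector p S y then
        bernWeight (Real.tanh (β * z + h)) x * channel p x y else 0) =
      (Real.exp (n * freeEnergy β h z) * bernWeight (Real.tanh (β * z + h)) x) *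
        (if sentiment S x ≠ detector p S y then channel p x y else 0) := by
    intro x y z
    split_ifs <;> ring
  simp_rw [iidError, Finset.mul_sum, hterm]
  rw [integral_finsetSum _ fun x _ => integrable_finsetSum _ fun y _ => (hint x).mul_const _]
  simp_rw [integral_finsetSum _ fun y _ => (hint _).mul_const _, integral_mul_const,
    integral_exp_freeEnergy_mul_bernWeight hn]
  rw [hden, errorProb, Finset.sum_mul]
  refine Finset.sum_congr rfl fun x _ => ?_
  rw [Finset.sum_mul]
  refine Finset.sum_congr rfl fun y _ => ?_
  split_ifs
  · rw [prior]; field_simp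
  · simp

/-- The Curie–Weiss error probability is a mixture of error probabilities for independent
spins. -/
theorem errorProb_eq_div {n : ℕ} (hn : n ≠ 0) {β : ℝ} (hβ : 0 < β) (h p S c : ℝ) :
    errorProb β h p S n =
      (∫ z, Real.exp (n * (freeEnergy β h z - c)) * iidError p S n (Real.tanh (β * z + h))) /
        ∫ z, Real.exp (n * (freeEnergy β h z - c)) := by
  rw [eq_div_iff (integral_exp_freeEnergy_pos hn hβ h c).ne']
  simp_rw [exp_sub_eq, mul_assoc]
  rw [integral_const_mul, integral_const_mul, integral_exp_freeEnergy_mul_iidError hn hβ]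
  ring

theorem measurable_iidError_tanh (p S : ℝ) (n : ℕ) (β h : ℝ) :
    Measurable fun z => iidError p S n (Real.tanh (β * z + h)) :=
  ((continuous_iidError p S n).comp (continuous_tanh.comp (by fun_prop))).measurable

theorem integrable_exp_freeEnergy_mul_iidError {n : ℕ} (hn : n ≠ 0) {β p : ℝ} (hβ : 0 < β)
    (hp0 : 0 ≤ p) (hp1 : p ≤ 1) (h S c : ℝ) :
    Integrable fun z =>
      Real.exp (n * (freeEnergy β h z - c)) * iidError p S n (Real.tanh (β * z + h)) := by
  refine (integrable_exp_freeEnergy hn hβ h c).mul_bdd (c := 1)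
    (measurable_iidError_tanh p S n β h).aestronglyMeasurable (ae_of_all _ fun z => ?_)
  rw [Real.norm_of_nonneg (iidError_nonneg hp0 hp1 S n (tanh_mem_Icc _))]
  exact iidError_le_one hp0 hp1 S n (tanh_mem_Icc _)

/-! ### Chernoff bound for independent spins -/

/-- The joint law of a spin with mean `m` and its image under the binary symmetric channel. -/
noncomputable def pairWeight (m p : ℝ) (a b : Bool) : ℝ :=
  (1 + m * spin a) / 2 * if b = a then 1 - p else p

theorem pairWeight_nonneg {m p : ℝ} (hm : m ∈ Icc (-1 : ℝ) 1) (hp0 : 0 ≤ p) (hp1 : p ≤ 1)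
    (a b : Bool) : 0 ≤ pairWeight m p a b := by
  refine mul_nonneg ?_ (by split_ifs <;> linarith)
  rw [spin]; split_ifs <;> linarith [hm.1, hm.2]

theorem sum_pairWeight (m p : ℝ) : ∑ a, ∑ b, pairWeight m p a b = 1 := by
  simp [pairWeight, spin]; ring

theorem bernWeight_mul_channel_eq_prod {n : ℕ} (m p : ℝ) (x y : Fin n → Bool) :
    bernWeight m x * channel p x y = ∏ i, pairWeight m p (x i) (y i) :=
  bernWeight_mul_channel m p x y

/-- Chernoff's bound for sums of independent centered bounded variables. -/
theorem chernoff {m p ε : ℝ} (hm : m ∈ Icc (-1 : ℝ) 1) (hp0 : 0 ≤ p) (hp1 : p ≤ 1)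
    {f : Bool → Bool → ℝ} (hf : ∀ a b, |f a b| ≤ 2)
    (hmean : ∑ a, ∑ b, pairWeight m p a b * f a b = 0) (hε0 : 0 ≤ ε) (hε : ε ≤ 4) (n : ℕ) :
    (∑ x : Fin n → Bool, ∑ y : Fin n → Bool,
      if n * ε ≤ ∑ i, f (x i) (y i) then bernWeight m x * channel p x y else 0) ≤
        Real.exp (-(n * (ε ^ 2 / 16))) := by
  -- Tilt by ε/8: since |f| ≤ 2 and ε ≤ 4, the exponent x is at most 1 in modulus, so e^x ≤ 1 + x +
  -- x² with x² ≤ ε²/16, and the linear term averages to zero. Markov contributes -ε²/8 per site,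
  -- leaving -ε²/16.
  have hone : ∑ a, ∑ b, pairWeight m p a b * Real.exp (ε / 8 * f a b) ≤
      Real.exp (ε ^ 2 / 16) := by
    have hb : ∀ a b, Real.exp (ε / 8 * f a b) ≤ 1 + ε / 8 * f a b + ε ^ 2 / 16 := by
      intro a b
      have h1 : |ε / 8 * f a b| ≤ 1 := by
        rw [abs_mul, abs_of_nonneg (by positivity)]
        nlinarith [hf a b, abs_nonneg (f a b)]
      have h2 := (abs_le.1 (Real.abs_exp_sub_one_sub_id_le h1)).2
      have h3 : f a b ^ 2 ≤ 4 := by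
        have := sq_le_sq' (by linarith [abs_nonneg (f a b)] : -2 ≤ |f a b|) (hf a b)
        rw [sq_abs] at this; linarith
      nlinarith [sq_nonneg ε]
    calc _ ≤ ∑ a, ∑ b, pairWeight m p a b * (1 + ε / 8 * f a b + ε ^ 2 / 16) := by
          gcongr with a _ b _
          · exact pairWeight_nonneg hm hp0 hp1 a b
          · exact hb a b
      _ = (1 + ε ^ 2 / 16) * ∑ a, ∑ b, pairWeight m p a b +
          ε / 8 * ∑ a, ∑ b, pairWeight m p a b * f a b := by
          simp only [Finset.mul_sum, ← Finset.sum_add_distrib]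
          refine Finset.sum_congr rfl fun a _ => Finset.sum_congr rfl fun b _ => ?_
          ring
      _ ≤ _ := by
          rw [sum_pairWeight, hmean]
          linarith [Real.add_one_le_exp (ε ^ 2 / 16)]
  have hterm : ∀ x y : Fin n → Bool,
      (if n * ε ≤ ∑ i, f (x i) (y i) then bernWeight m x * channel p x y else 0) ≤
      Real.exp (-(n * (ε ^ 2 / 8))) *
        ∏ i, (pairWeight m p (x i) (y i) * Real.exp (ε / 8 * f (x i) (y i))) := by
    intro x y
    rw [Finset.prod_mul_distrib, ← bernWeight_mul_channel_eq_prod, ← Real.exp_sum,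
      ← Finset.mul_sum, mul_left_comm, ← Real.exp_add]
    have h0 := mul_nonneg (bernWeight_nonneg hm x) (channel_nonneg hp0 hp1 x y)
    split_ifs with h
    · refine le_mul_of_one_le_right h0 (Real.one_le_exp ?_)
      nlinarith
    · positivity
  calc _ ≤ ∑ x : Fin n → Bool, ∑ y : Fin n → Bool, Real.exp (-(n * (ε ^ 2 / 8))) *
        ∏ i, (pairWeight m p (x i) (y i) * Real.exp (ε / 8 * f (x i) (y i))) :=
        Finset.sum_le_sum fun x _ => Finset.sum_le_sum fun y _ => hterm x y
    _ = Real.exp (-(n * (ε ^ 2 / 8))) *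
        (∑ a, ∑ b, pairWeight m p a b * Real.exp (ε / 8 * f a b)) ^ n := by
        rw [← sum_sum_prod n (fun a b => pairWeight m p a b * Real.exp (ε / 8 * f a b))]
        simp_rw [Finset.mul_sum]
    _ ≤ Real.exp (-(n * (ε ^ 2 / 8))) * Real.exp (ε ^ 2 / 16) ^ n := by
        gcongr
        exact Finset.sum_nonneg fun a _ => Finset.sum_nonneg fun b _ =>
          mul_nonneg (pairWeight_nonneg hm hp0 hp1 a b) (Real.exp_pos _).le
    _ = _ := by
        rw [← Real.exp_nat_mul, ← Real.exp_add]
        ring_nf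

theorem abs_spin (b : Bool) : |spin b| = 1 := by cases b <;> simp [spin]

theorem sign_eq_of_mul_neg {η a b : ℝ} (ha : η * a < 0) (hb : η * b < 0) :
    SignType.sign a = SignType.sign b := by
  rcases lt_trichotomy η 0 with h | rfl | h
  · rw [sign_pos (by nlinarith), sign_pos (by nlinarith)]
  · simp at ha
  · rw [sign_neg (by nlinarith), sign_neg (by nlinarith)]

/-- The error probability for independent spins is exponentially small off the threshold. -/
theorem iidError_le {m p S : ℝ} (hm : m ∈ Icc (-1 : ℝ) 1) (hp0 : 0 ≤ p) (hp : p < 1 / 2)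
    (hS : S ∈ Ioo (-1 : ℝ) 1) {n : ℕ} (hn : n ≠ 0) :
    iidError p S n m ≤ 2 * Real.exp (-(n * ((1 - 2 * p) ^ 2 / 16 * (m - S) ^ 2))) := by
  have hn' : 0 < (n : ℝ) := Nat.cast_pos.2 (Nat.pos_of_ne_zero hn)
  have hp1 : p ≤ 1 := by linarith
  -- The sign η is opposite to that of m - S, so that a wrong sign of either average is an upper
  -- deviation of a centred sum.
  obtain ⟨η, hη, hηm⟩ : ∃ η : ℝ, |η| = 1 ∧ η * (m - S) = -|m - S| := by
    rcases le_total 0 (m - S) with h | h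
    · exact ⟨-1, by simp, by rw [abs_of_nonneg h]; ring⟩
    · exact ⟨1, by simp, by rw [abs_of_nonpos h]; ring⟩
  have habs : |m - S| ≤ 2 := abs_le.2 ⟨by linarith [hm.1, hS.2], by linarith [hm.2, hS.1]⟩
  have hma : |m| ≤ 1 := abs_le.2 hm
  set f₁ : Bool → Bool → ℝ := fun a _ => η * (spin a - m) with hf₁
  set f₂ : Bool → Bool → ℝ := fun _ b => η * (spin b - (1 - 2 * p) * m) with hf₂
  have c₁ := chernoff (f := f₁) hm hp0 hp1
    (fun a b => by
      rw [hf₁, abs_mul, hη, one_mul]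
      exact (abs_sub _ _).trans (by rw [abs_spin]; linarith))
    (by simp [hf₁, pairWeight, spin]; ring) (ε := |m - S|) (abs_nonneg _) (by linarith) n
  have c₂ := chernoff (f := f₂) hm hp0 hp1
    (fun a b => by
      rw [hf₂, abs_mul, hη, one_mul]
      refine (abs_sub _ _).trans ?_
      rw [abs_spin, abs_mul, abs_of_nonneg (by linarith : 0 ≤ 1 - 2 * p)]
      nlinarith [abs_nonneg m])
    (by simp [hf₂, pairWeight, spin]; ring) (ε := (1 - 2 * p) * |m - S|)
    (mul_nonneg (by linarith) (abs_nonneg _)) (by nlinarith [abs_nonneg (m - S)]) n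
  have hcover : iidError p S n m ≤
      (∑ x : Fin n → Bool, ∑ y : Fin n → Bool,
        if n * |m - S| ≤ ∑ i, f₁ (x i) (y i) then bernWeight m x * channel p x y else 0) +
      ∑ x : Fin n → Bool, ∑ y : Fin n → Bool,
        if n * ((1 - 2 * p) * |m - S|) ≤ ∑ i, f₂ (x i) (y i) then
          bernWeight m x * channel p x y else 0 := by
    rw [← Finset.sum_add_distrib]
    refine Finset.sum_le_sum fun x _ => ?_
    rw [← Finset.sum_add_distrib]
    refine Finset.sum_le_sum fun y _ => ?_
    have h0 := mul_nonneg (bernWeight_nonneg hm x) (channel_nonneg hp0 hp1 x y)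
    by_cases h1 : n * |m - S| ≤ ∑ i, f₁ (x i) (y i)
    · rw [if_pos h1]; split_ifs <;> linarith
    by_cases h2 : n * ((1 - 2 * p) * |m - S|) ≤ ∑ i, f₂ (x i) (y i)
    · rw [if_pos h2]; split_ifs <;> linarith
    -- When neither sum deviates, η times each of the two thresholded averages is negative, so their
    -- signs agree.
    rw [if_neg h1, if_neg h2, if_neg, add_zero]
    rw [not_not]
    have e1 : ∑ i, f₁ (x i) (y i) = n * (η * (avgSpin x - S) - η * (m - S)) := by
      simp only [hf₁, avgSpin, totalSpin, ← Finset.mul_sum, Finset.sum_sub_distrib]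
      simp
      field_simp
      ring
    have e2 : ∑ i, f₂ (x i) (y i) =
        n * (η * (avgSpin y - (1 - 2 * p) * S) - (1 - 2 * p) * (η * (m - S))) := by
      simp only [hf₂, avgSpin, totalSpin, ← Finset.mul_sum, Finset.sum_sub_distrib]
      simp
      field_simp
      ring
    rw [e1, mul_le_mul_iff_right₀ hn', hηm] at h1
    rw [e2, mul_le_mul_iff_right₀ hn', hηm] at h2
    exact sign_eq_of_mul_neg (η := η) (by linarith) (by linarith)
  have hle : Real.exp (-(n * (|m - S| ^ 2 / 16))) ≤
      Real.exp (-(n * ((1 - 2 * p) ^ 2 / 16 * (m - S) ^ 2))) := by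
    rw [sq_abs]
    gcongr
    have : (1 - 2 * p) ^ 2 ≤ 1 := by nlinarith
    nlinarith [sq_nonneg (m - S)]
  have heq : Real.exp (-(n * (((1 - 2 * p) * |m - S|) ^ 2 / 16))) =
      Real.exp (-(n * ((1 - 2 * p) ^ 2 / 16 * (m - S) ^ 2))) := by
    rw [mul_pow, sq_abs]; ring_nf
  linarith

/-! ### Exponential decay away from the maximizers -/

/-- Exponential decay of the error probability when the threshold is not a maximizer of the free
energy. -/
theorem exists_errorProb_le {β h p S μ : ℝ} (hβ : 0 < β) (hp0 : 0 ≤ p) (hp : p < 1 / 2)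
    (hS : S ∈ Ioo (-1 : ℝ) 1)
    (hlt : freeEnergy β h ((Real.artanh S - h) / β) < freeEnergy β h μ) :
    ∃ C > 0, ∃ c > 0, ∀ n : ℕ, n ≠ 0 → errorProb β h p S n ≤ C * Real.exp (-(c * n)) := by
  -- The only z whose product law has mean exactly S.
  set z₀ := (Real.artanh S - h) / β with hz₀
  set d := (freeEnergy β h μ - freeEnergy β h z₀) / 2 with hd
  have hd0 : 0 < d := by rw [hd]; linarith
  have hcont := continuous_freeEnergy β h
  obtain ⟨r, hr, hrd⟩ : ∃ r > 0, ∀ z ∈ Icc (z₀ - r) (z₀ + r),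
      freeEnergy β h z ≤ freeEnergy β h μ - d := by
    have := (hcont.tendsto z₀).eventually (ge_mem_nhds (show freeEnergy β h z₀ <
      freeEnergy β h μ - d by rw [hd]; linarith))
    obtain ⟨r, hr, hb⟩ := Metric.nhds_basis_closedBall.mem_iff.1 this
    exact ⟨r, hr, fun z hz => hb (by rwa [Real.closedBall_eq_Icc])⟩
  obtain ⟨s, hs, hsd⟩ : ∃ s > 0, ∀ z ∈ Icc (μ - s) (μ + s),
      freeEnergy β h μ - d / 2 ≤ freeEnergy β h z := by
    have := (hcont.tendsto μ).eventually (le_mem_nhds (show freeEnergy β h μ - d / 2 <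
      freeEnergy β h μ by linarith))
    obtain ⟨r, hr, hb⟩ := Metric.nhds_basis_closedBall.mem_iff.1 this
    exact ⟨r, hr, fun z hz => hb (by rwa [Real.closedBall_eq_Icc])⟩
  have htS : Real.tanh (β * z₀ + h) = S := by
    rw [hz₀, mul_div_cancel₀ _ hβ.ne', sub_add_cancel, Real.tanh_artanh hS]
  have hmono : StrictMono fun z => Real.tanh (β * z + h) :=
    tanh_strictMono.comp fun a b hab => by nlinarith
  obtain ⟨ε, hε, hεz⟩ : ∃ ε > 0, ∀ z, z ∉ Icc (z₀ - r) (z₀ + r) →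
      ε ≤ |Real.tanh (β * z + h) - S| := by
    refine ⟨min (S - Real.tanh (β * (z₀ - r) + h)) (Real.tanh (β * (z₀ + r) + h) - S),
      lt_min ?_ ?_, fun z hz => ?_⟩
    · rw [sub_pos, ← htS]; exact hmono (by linarith)
    · rw [sub_pos]; nth_rw 1 [← htS]; exact hmono (by linarith)
    · rw [mem_Icc, not_and_or, not_le, not_le] at hz
      rcases hz with hz | hz
      · refine (min_le_left _ _).trans ((?_ : _ ≤ _).trans (neg_le_abs _))
        linarith [hmono hz]
      · refine (min_le_right _ _).trans ((?_ : _ ≤ _).trans (le_abs_self _))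
        linarith [hmono hz]
  set c₁ := (1 - 2 * p) ^ 2 / 16 * ε ^ 2 with hc₁
  have hp2 : 0 < 1 - 2 * p := by linarith
  have hc₁0 : 0 < c₁ := by positivity
  -- The 2 is the Chernoff prefactor; r / s compares the window around z₀, which bounds the
  -- numerator, with the window around μ, which bounds the denominator.
  refine ⟨2 + r / s, by positivity, min c₁ (d / 2), lt_min hc₁0 (by positivity), fun n hn => ?_⟩
  have hn' : 0 < (n : ℝ) := Nat.cast_pos.2 (Nat.pos_of_ne_zero hn)
  set E : ℝ → ℝ := fun z => Real.exp (n * (freeEnergy β h z - freeEnergy β h μ)) with hE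
  have hEint : Integrable E := integrable_exp_freeEnergy hn hβ h _
  have hE0 : ∀ z, 0 < E z := fun z => Real.exp_pos _
  have hDpos : 0 < ∫ z, E z := integral_exp_freeEnergy_pos hn hβ h _
  -- On the window around z₀ the error is bounded by 1 and the density by e^{-nd}; outside it the
  -- mean is ε away from S and Chernoff applies.
  have hnum : ∫ z, E z * iidError p S n (Real.tanh (β * z + h)) ≤
      2 * Real.exp (-(n * c₁)) * (∫ z, E z) + 2 * r * Real.exp (-(n * d)) := by
    have hI : Integrable ((Icc (z₀ - r) (z₀ + r)).indicator fun _ => Real.exp (-(n * d))) :=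
      (integrable_indicator_iff measurableSet_Icc).2 (integrableOn_const (by simp))
    have hint : ∫ z, (2 * Real.exp (-(n * c₁)) * E z +
        (Icc (z₀ - r) (z₀ + r)).indicator (fun _ => Real.exp (-(n * d))) z) =
        2 * Real.exp (-(n * c₁)) * (∫ z, E z) + 2 * r * Real.exp (-(n * d)) := by
      rw [integral_add (hEint.const_mul _) hI, integral_const_mul,
        integral_indicator measurableSet_Icc, setIntegral_const]
      rw [measureReal_def, Real.volume_Icc, ENNReal.toReal_ofReal (by linarith), smul_eq_mul]
      ring
    rw [← hint]
    refine integral_mono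
      (integrable_exp_freeEnergy_mul_iidError hn hβ hp0 (by linarith) h S _)
      ((hEint.const_mul _).add hI) fun z => ?_
    by_cases hz : z ∈ Icc (z₀ - r) (z₀ + r)
    · have h1 : E z * iidError p S n (Real.tanh (β * z + h)) ≤ E z * 1 :=
        mul_le_mul_of_nonneg_left (iidError_le_one hp0 (by linarith) S n (tanh_mem_Icc _))
          (hE0 z).le
      have h2 : E z ≤ Real.exp (-(n * d)) := by
        refine Real.exp_le_exp.2 ?_
        nlinarith [hrd z hz]
      have h3 : 0 ≤ 2 * Real.exp (-(n * c₁)) * E z := by have := hE0 z; positivity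
      simp only [indicator_of_mem hz]
      linarith
    · simp only [indicator_of_notMem hz, add_zero]
      rw [mul_comm (2 * _)]
      refine mul_le_mul_of_nonneg_left
        ((iidError_le (tanh_mem_Icc _) hp0 hp hS hn).trans ?_) (hE0 z).le
      have : ε ^ 2 ≤ (Real.tanh (β * z + h) - S) ^ 2 := by
        rw [← sq_abs (Real.tanh _ - S)]
        exact pow_le_pow_left₀ hε.le (hεz z hz) 2
      rw [hc₁]
      gcongr
  -- Near μ only half of the gap d is lost, so the numerator's e^{-nd} still wins by e^{-nd/2}.
  have hden : 2 * s * Real.exp (-(n * (d / 2))) ≤ ∫ z, E z := by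
    have h1 : ∫ z in Icc (μ - s) (μ + s), Real.exp (-(n * (d / 2))) ≤
        ∫ z in Icc (μ - s) (μ + s), E z := by
      refine setIntegral_mono_on (integrableOn_const (by simp)) hEint.integrableOn
        measurableSet_Icc fun z hz => Real.exp_le_exp.2 ?_
      nlinarith [hsd z hz]
    rw [setIntegral_const, measureReal_def, Real.volume_Icc, ENNReal.toReal_ofReal (by linarith),
      smul_eq_mul] at h1
    have h2 := setIntegral_le_integral (s := Icc (μ - s) (μ + s)) hEint
      (ae_of_all _ fun z => (hE0 z).le)
    linarith
  rw [errorProb_eq_div hn hβ h p S (freeEnergy β h μ), div_le_iff₀ hDpos]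
  refine hnum.trans ?_
  have e1 : Real.exp (-(n * c₁)) ≤ Real.exp (-(min c₁ (d / 2) * n)) := by
    refine Real.exp_le_exp.2 ?_
    nlinarith [min_le_left c₁ (d / 2)]
  have e2 : Real.exp (-(n * (d / 2))) ≤ Real.exp (-(min c₁ (d / 2) * n)) := by
    refine Real.exp_le_exp.2 ?_
    nlinarith [min_le_right c₁ (d / 2)]
  have e3 : 2 * r * Real.exp (-(n * d)) =
      r / s * Real.exp (-(n * (d / 2))) * (2 * s * Real.exp (-(n * (d / 2)))) := by
    rw [show -(n * d) = -(n * (d / 2)) + -(n * (d / 2)) by ring, Real.exp_add]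
    field_simp
  rw [e3]
  calc _ ≤ 2 * Real.exp (-(min c₁ (d / 2) * n)) * (∫ z, E z) +
        r / s * Real.exp (-(min c₁ (d / 2) * n)) * (∫ z, E z) := by gcongr
    _ = _ := by ring

theorem errorProb_nonneg {β h p : ℝ} (hp0 : 0 ≤ p) (hp1 : p ≤ 1) (S : ℝ) (n : ℕ) :
    0 ≤ errorProb β h p S n :=
  Finset.sum_nonneg fun x _ => Finset.sum_nonneg fun y _ => by
    split_ifs
    · exact mul_nonneg (div_nonneg (Real.exp_pos _).le
        (Finset.sum_nonneg fun _ _ => (Real.exp_pos _).le)) (channel_nonneg hp0 hp1 x y)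
    · exact le_rfl

theorem tendsto_errorProb_zero {β h p S C c : ℝ} (hp0 : 0 ≤ p) (hp1 : p ≤ 1) (hc : 0 < c)
    (hle : ∀ n : ℕ, n ≠ 0 → errorProb β h p S n ≤ C * Real.exp (-(c * n))) :
    Tendsto (errorProb β h p S) atTop (𝓝 0) := by
  refine squeeze_zero' (Eventually.of_forall fun n => errorProb_nonneg hp0 hp1 S n)
    ((eventually_ne_atTop 0).mono hle) ?_
  rw [← mul_zero C]
  refine (Real.tendsto_exp_neg_atTop_nhds_zero.comp ?_).const_mul C
  exact tendsto_natCast_atTop_atTop.const_mul_atTop hc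

/-- Eventually log C / n ≤ c/2, which leaves a rate of at most -c/2. Monotonicity of the extended
logarithm covers the n at which the error probability is 0. -/
theorem errorRate_neg {β h p S C c : ℝ} (hC : 0 < C) (hc : 0 < c)
    (hle : ∀ n : ℕ, n ≠ 0 → errorProb β h p S n ≤ C * Real.exp (-(c * n))) :
    errorRate β h p S < 0 := by
  have hlim : Tendsto (fun n : ℕ => 1 / (n : ℝ) * Real.log C) atTop (𝓝 0) := by
    simpa using tendsto_one_div_atTop_nhds_zero_nat.mul_const (Real.log C)
  have hev : ∀ᶠ n : ℕ in atTop, ((1 / (n : ℝ) : ℝ) : EReal) *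
      ENNReal.log (ENNReal.ofReal (errorProb β h p S n)) ≤ ((-(c / 2) : ℝ) : EReal) := by
    filter_upwards [eventually_ne_atTop 0, hlim.eventually (ge_mem_nhds (half_pos hc))]
      with n hn hn2
    have hn' : 0 < (n : ℝ) := Nat.cast_pos.2 (Nat.pos_of_ne_zero hn)
    have h1 : ENNReal.log (ENNReal.ofReal (errorProb β h p S n)) ≤
        ((Real.log C - c * n : ℝ) : EReal) := by
      refine (ENNReal.log_monotone (ENNReal.ofReal_le_ofReal (hle n hn))).trans ?_
      rw [ENNReal.log_ofReal_of_pos (by positivity), Real.log_mul hC.ne' (Real.exp_pos _).ne',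
        Real.log_exp, sub_eq_add_neg]
    refine (mul_le_mul_of_nonneg_left h1 (by exact_mod_cast (by positivity))).trans ?_
    rw [← EReal.coe_mul, EReal.coe_le_coe_iff, mul_sub]
    have : 1 / (n : ℝ) * (c * n) = c := by field_simp
    linarith
  refine (limsup_le_of_le (by isBoundedDefault) hev).trans_lt ?_
  exact_mod_cast (by linarith : -(c / 2) < 0)

/-! ### Laplace's method for the mixing integral -/

/-- Second-order expansion of the free energy at a critical point. -/
theorem tendsto_freeEnergy_sub_div_sq {β h μ : ℝ} (hfix : Real.tanh (β * μ + h) = μ) :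
    Tendsto (fun z => (freeEnergy β h z - freeEnergy β h μ) / (z - μ) ^ 2) (𝓝[≠] μ)
      (𝓝 (-(β * (1 - β * (1 - μ ^ 2)) / 2))) := by
  have hs := hasDerivAt_iff_tendsto_slope.1 (hasDerivAt_tanh_sub β h μ)
  rw [hfix] at hs
  -- After one differentiation the quotient is β/2 times the slope at μ of tanh(β z + h) - z, so no
  -- second derivative of the free energy is needed.
  refine HasDerivAt.lhopital_zero_nhdsNE (f' := fun z => β * (Real.tanh (β * z + h) - z))
    (g' := fun z => 2 * (z - μ)) ?_ ?_ ?_ ?_ ?_ ?_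
  · exact Eventually.of_forall fun z => (hasDerivAt_freeEnergy β h z).sub_const _
  · refine Eventually.of_forall fun z => ?_
    exact (((hasDerivAt_id z).sub_const μ).pow 2).congr_deriv (by simp)
  · filter_upwards [self_mem_nhdsWithin] with z hz
    exact mul_ne_zero two_ne_zero (sub_ne_zero.2 hz)
  · refine tendsto_nhdsWithin_of_tendsto_nhds ?_
    simpa using ((continuous_freeEnergy β h).tendsto μ).sub_const (freeEnergy β h μ)
  · refine tendsto_nhdsWithin_of_tendsto_nhds ?_
    have : Continuous fun z : ℝ => (z - μ) ^ 2 := by fun_prop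
    simpa using this.tendsto μ
  · have := hs.const_mul (β / 2)
    rw [show β / 2 * (β * (1 - μ ^ 2) - 1) = -(β * (1 - β * (1 - μ ^ 2)) / 2) by ring] at this
    refine this.congr' ?_
    filter_upwards [self_mem_nhdsWithin] with z hz
    have : z - μ ≠ 0 := sub_ne_zero.2 hz
    rw [slope_def_field, hfix]
    field_simp
    ring

theorem tendsto_inv_sqrt_natCast : Tendsto (fun n : ℕ => (√(n : ℝ))⁻¹) atTop (𝓝 0) :=
  tendsto_inv_atTop_zero.comp (Real.tendsto_sqrt_atTop.comp tendsto_natCast_atTop_atTop)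

theorem tendsto_add_mul_inv_sqrt (μ u : ℝ) :
    Tendsto (fun n : ℕ => μ + (√(n : ℝ))⁻¹ * u) atTop (𝓝 μ) := by
  simpa using (tendsto_inv_sqrt_natCast.mul_const u).const_add μ

theorem tendsto_mul_freeEnergy_sub {β h μ : ℝ} (hfix : Real.tanh (β * μ + h) = μ) (u : ℝ) :
    Tendsto (fun n : ℕ => n * (freeEnergy β h (μ + (√(n : ℝ))⁻¹ * u) - freeEnergy β h μ)) atTop
      (𝓝 (-(β * (1 - β * (1 - μ ^ 2))) / 2 * u ^ 2)) := by
  rcases eq_or_ne u 0 with rfl | hu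
  · simp
  have hne : Tendsto (fun n : ℕ => μ + (√(n : ℝ))⁻¹ * u) atTop (𝓝[≠] μ) := by
    refine tendsto_nhdsWithin_iff.2 ⟨tendsto_add_mul_inv_sqrt μ u, ?_⟩
    filter_upwards [eventually_gt_atTop 0] with n hn
    have : 0 < √(n : ℝ) := Real.sqrt_pos.2 (Nat.cast_pos.2 hn)
    simp [hu, this.ne']
  have := ((tendsto_freeEnergy_sub_div_sq hfix).comp hne).mul_const (u ^ 2)
  rw [neg_div]
  refine this.congr' ?_
  filter_upwards [eventually_gt_atTop 0] with n hn
  have hn' : 0 < (n : ℝ) := Nat.cast_pos.2 hn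
  have hs : 0 < √(n : ℝ) := Real.sqrt_pos.2 hn'
  have hsq : √(n : ℝ) ^ 2 = n := Real.sq_sqrt hn'.le
  simp only [Function.comp, add_sub_cancel_left]
  rw [mul_pow, inv_pow, hsq]
  field_simp

/-- log cosh grows only linearly. Half of the quadratic coefficient β/2 is spent on absorbing the
linear term B|z - μ| and the constant K, which R makes possible. -/
theorem freeEnergy_sub_le_of_le_abs {β h μ : ℝ} (hβ : 0 < β) :
    ∃ R > 0, ∀ z, R ≤ |z - μ| →
      freeEnergy β h z - freeEnergy β h μ ≤ -(β / 4 * (z - μ) ^ 2) := by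
  set B := β * (1 + |μ|)
  set K := Real.log 2 + |β * μ + h| - freeEnergy β h μ
  refine ⟨1 + 4 * (B + |K|) / β, by positivity, fun z hz => ?_⟩
  have hlog : Real.log (2 * Real.cosh (β * z + h)) ≤ Real.log 2 + |β * z + h| := by
    rw [Real.log_mul two_ne_zero (Real.cosh_pos _).ne']
    gcongr
    rw [← Real.log_exp |β * z + h|]
    refine Real.log_le_log (Real.cosh_pos _) ?_
    rw [← Real.cosh_abs, Real.cosh_eq]
    have := Real.exp_le_exp.2 (show -|β * z + h| ≤ |β * z + h| by
      linarith [abs_nonneg (β * z + h)])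
    linarith
  have h1 : |β * z + h| ≤ |β * μ + h| + β * |z - μ| := by
    rw [show β * z + h = (β * μ + h) + β * (z - μ) by ring]
    refine (abs_add_le _ _).trans ?_
    rw [abs_mul, abs_of_pos hβ]
  have h2 : -(β * |μ| * |z - μ|) ≤ β * (μ * (z - μ)) := by
    rw [mul_assoc, ← mul_neg, ← abs_mul]
    exact mul_le_mul_of_nonneg_left (neg_abs_le _) hβ.le
  have h3 : 1 ≤ |z - μ| := le_trans (by simp; positivity) hz
  have h4 : B + |K| ≤ β / 4 * |z - μ| := by
    have : 4 * (B + |K|) / β ≤ |z - μ| := by linarith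
    rw [div_le_iff₀ hβ] at this
    linarith
  have h5 : B * |z - μ| + |K| ≤ β / 4 * (z - μ) ^ 2 := by
    rw [← sq_abs (z - μ)]
    nlinarith [abs_nonneg K, abs_nonneg (z - μ)]
  have h6 : freeEnergy β h z - freeEnergy β h μ ≤
      -(β / 2 * (z - μ) ^ 2) + B * |z - μ| + K := by
    have hz2 : β * z ^ 2 / 2 = β / 2 * (z - μ) ^ 2 + β * (μ * (z - μ)) + β / 2 * μ ^ 2 := by ring
    have : 0 ≤ β / 2 * μ ^ 2 := by positivity
    have hB : B * |z - μ| = β * |z - μ| + β * |μ| * |z - μ| := by simp only [B]; ring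
    have hfz : freeEnergy β h z =
      Real.log (2 * Real.cosh (β * z + h)) - β * z ^ 2 / 2 := rfl
    linarith
  linarith [le_abs_self K]

/-- A strict nondegenerate maximizer on a closed set is a quadratic maximizer. -/
theorem exists_quadratic_bound {β h μ : ℝ} (hβ : 0 < β) (hfix : Real.tanh (β * μ + h) = μ)
    (hnd : β * (1 - μ ^ 2) < 1) {A : Set ℝ} (hA : IsClosed A)
    (hmax : ∀ z ∈ A, z ≠ μ → freeEnergy β h z < freeEnergy β h μ) :
    ∃ c > 0, ∀ z ∈ A, freeEnergy β h z - freeEnergy β h μ ≤ -(c * (z - μ) ^ 2) := by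
  set κ := β * (1 - β * (1 - μ ^ 2)) with hκ
  have hκ0 : 0 < κ := mul_pos hβ (by linarith)
  -- Three regimes: the second-order expansion for |z - μ| < r, growth at infinity for |z - μ| ≥ R,
  -- and in between a strict gap m by compactness.
  obtain ⟨r, hr, hrb⟩ : ∃ r > 0, ∀ z, |z - μ| < r →
      freeEnergy β h z - freeEnergy β h μ ≤ -(κ / 4 * (z - μ) ^ 2) := by
    have := (tendsto_freeEnergy_sub_div_sq hfix).eventually
      (ge_mem_nhds (show -(κ / 2) < -(κ / 4) by linarith))
    rw [eventually_nhdsWithin_iff] at this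
    obtain ⟨r, hr, hb⟩ := Metric.eventually_nhds_iff.1 this
    refine ⟨r, hr, fun z hz => ?_⟩
    by_cases hzμ : z = μ
    · simp [hzμ]
    · have h1 := hb (by rwa [Real.dist_eq]) hzμ
      have h2 : 0 < (z - μ) ^ 2 := by have := sub_ne_zero.2 hzμ; positivity
      rw [div_le_iff₀ h2] at h1
      linarith
  obtain ⟨R, hR, hRb⟩ := freeEnergy_sub_le_of_le_abs (h := h) (μ := μ) hβ
  obtain ⟨m, hm, hmb⟩ : ∃ m > 0, ∀ z ∈ A, r ≤ |z - μ| → |z - μ| ≤ R →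
      freeEnergy β h z - freeEnergy β h μ ≤ -m := by
    have hK : IsCompact (A ∩ {z | r ≤ |z - μ|} ∩ Metric.closedBall μ R) :=
      (isCompact_closedBall μ R).inter_left
        (hA.inter (isClosed_le continuous_const (by fun_prop)))
    rcases (A ∩ {z | r ≤ |z - μ|} ∩ Metric.closedBall μ R).eq_empty_or_nonempty with he | hne
    · refine ⟨1, one_pos, fun z hz h1 h2 => ?_⟩
      have : z ∈ (∅ : Set ℝ) := he ▸ ⟨⟨hz, h1⟩, by rwa [Metric.mem_closedBall, Real.dist_eq]⟩
      exact this.elim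
    · obtain ⟨w, hw, hwm⟩ := hK.exists_isMaxOn hne (continuous_freeEnergy β h).continuousOn
      have hwμ : w ≠ μ := by
        rintro rfl
        have : r ≤ |w - w| := hw.1.2
        simp at this; linarith
      refine ⟨freeEnergy β h μ - freeEnergy β h w, by linarith [hmax w hw.1.1 hwμ],
        fun z hz h1 h2 => ?_⟩
      have : freeEnergy β h z ≤ freeEnergy β h w :=
        hwm ⟨⟨hz, h1⟩, by rwa [Metric.mem_closedBall, Real.dist_eq]⟩
      linarith
  refine ⟨min (κ / 4) (min (β / 4) (m / R ^ 2)),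
    lt_min (by positivity) (lt_min (by positivity) (by positivity)), fun z hz => ?_⟩
  have hq := sq_nonneg (z - μ)
  rcases lt_or_ge |z - μ| r with h1 | h1
  · have := mul_le_mul_of_nonneg_right
      (min_le_left (κ / 4) (min (β / 4) (m / R ^ 2))) hq
    linarith [hrb z h1]
  rcases le_or_gt R |z - μ| with h2 | h2
  · have := mul_le_mul_of_nonneg_right
      ((min_le_right (κ / 4) (min (β / 4) (m / R ^ 2))).trans (min_le_left _ _)) hq
    linarith [hRb z h2]
  · have h3 := mul_le_mul_of_nonneg_right
      ((min_le_right (κ / 4) (min (β / 4) (m / R ^ 2))).trans (min_le_right _ _)) hq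
    have h4 : m / R ^ 2 * (z - μ) ^ 2 ≤ m := by
      have : (z - μ) ^ 2 ≤ R ^ 2 := by
        rw [← sq_abs (z - μ)]; exact pow_le_pow_left₀ (abs_nonneg _) h2.le 2
      calc _ ≤ m / R ^ 2 * R ^ 2 := by gcongr
        _ = m := by field_simp
    linarith [hmb z hz h1 h2.le]

theorem integral_comp_add_inv_sqrt_mul {n : ℕ} (hn : n ≠ 0) (μ : ℝ) (F : ℝ → ℝ) :
    ∫ u, F (μ + (√(n : ℝ))⁻¹ * u) = √(n : ℝ) * ∫ z, F z := by
  have hs : 0 < √(n : ℝ) := Real.sqrt_pos.2 (Nat.cast_pos.2 (Nat.pos_of_ne_zero hn))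
  rw [Measure.integral_comp_mul_left (fun v => F (μ + v)) (√(n : ℝ))⁻¹,
    integral_add_left_eq_self F μ, inv_inv, abs_of_pos hs, smul_eq_mul]

/-- Laplace's method near a nondegenerate maximizer of the free energy. -/
theorem tendsto_laplace {β h μ : ℝ} (hβ : 0 < β) (hfix : Real.tanh (β * μ + h) = μ)
    (hnd : β * (1 - μ ^ 2) < 1) {A : Set ℝ} (hA : IsClosed A) (hAμ : A ∈ 𝓝 μ)
    (hmax : ∀ z ∈ A, z ≠ μ → freeEnergy β h z < freeEnergy β h μ)
    {Q : ℕ → ℝ → ℝ} {q : ℝ → ℝ} (hQm : ∀ n, Measurable (Q n)) (hQ0 : ∀ n z, 0 ≤ Q n z)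
    (hQ1 : ∀ n z, Q n z ≤ 1)
    (hQ : ∀ u, Tendsto (fun n : ℕ => Q n (μ + (√(n : ℝ))⁻¹ * u)) atTop (𝓝 (q u))) :
    Tendsto (fun n : ℕ => √(n : ℝ) *
        ∫ z in A, Real.exp (n * (freeEnergy β h z - freeEnergy β h μ)) * Q n z) atTop
      (𝓝 (∫ u, Real.exp (-(β * (1 - β * (1 - μ ^ 2))) / 2 * u ^ 2) * q u)) := by
  obtain ⟨c, hc, hcb⟩ := exists_quadratic_bound hβ hfix hnd hA hmax
  set F : ℕ → ℝ → ℝ := fun n =>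
    A.indicator fun z => Real.exp (n * (freeEnergy β h z - freeEnergy β h μ)) * Q n z with hF
  have hFm : ∀ n, Measurable (F n) := fun n =>
    ((Real.continuous_exp.comp (continuous_const.mul
      ((continuous_freeEnergy β h).sub continuous_const))).measurable.mul (hQm n)).indicator
      hA.measurableSet
  have hmain : Tendsto (fun n : ℕ => ∫ u, F n (μ + (√(n : ℝ))⁻¹ * u)) atTop
      (𝓝 (∫ u, Real.exp (-(β * (1 - β * (1 - μ ^ 2))) / 2 * u ^ 2) * q u)) := by
    -- At scale 1/√n the quadratic bound becomes the majorant e^{-c u²}, which is free of n.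
    refine tendsto_integral_filter_of_dominated_convergence (fun u => Real.exp (-c * u ^ 2))
      ?_ ?_ (integrable_exp_neg_mul_sq hc) ?_
    · exact Eventually.of_forall fun n =>
        ((hFm n).comp (measurable_const.add (measurable_const.mul measurable_id))
          ).aestronglyMeasurable
    · filter_upwards [eventually_gt_atTop 0] with n hn
      refine ae_of_all _ fun u => ?_
      simp only [hF]
      by_cases hz : μ + (√(n : ℝ))⁻¹ * u ∈ A
      · rw [indicator_of_mem hz, norm_mul, Real.norm_of_nonneg (Real.exp_pos _).le,
          Real.norm_of_nonneg (hQ0 _ _)]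
        refine (mul_le_of_le_one_right (Real.exp_pos _).le (hQ1 _ _)).trans
          (Real.exp_le_exp.2 ?_)
        have hn' : 0 < (n : ℝ) := Nat.cast_pos.2 hn
        have h1 := mul_le_mul_of_nonneg_left (hcb _ hz) hn'.le
        refine h1.trans (le_of_eq ?_)
        rw [add_sub_cancel_left, mul_pow, inv_pow, Real.sq_sqrt hn'.le]
        field_simp
      · rw [indicator_of_notMem hz, norm_zero]
        positivity
    · refine ae_of_all _ fun u => ?_
      have h1 := ((Real.continuous_exp.tendsto _).comp (tendsto_mul_freeEnergy_sub hfix u)).mul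
        (hQ u)
      refine h1.congr' ?_
      -- A is a neighbourhood of μ, so for fixed u the indicator is eventually 1.
      filter_upwards [(tendsto_add_mul_inv_sqrt μ u).eventually hAμ] with n hn
      simp only [hF, Function.comp]
      rw [indicator_of_mem hn]
  refine hmain.congr' ?_
  filter_upwards [eventually_ne_atTop 0] with n hn
  rw [integral_comp_add_inv_sqrt_mul hn, integral_indicator hA.measurableSet]

/-- At a degenerate maximizer, the Laplace integral is of larger order than `1 / √n`. -/
theorem tendsto_sqrt_mul_integral_atTop {β h μ : ℝ} (hβ : 0 < β)
    (hfix : Real.tanh (β * μ + h) = μ) (hdeg : β * (1 - μ ^ 2) = 1)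
    (hmax : ∀ z, freeEnergy β h z ≤ freeEnergy β h μ) :
    Tendsto (fun n : ℕ => √(n : ℝ) *
        ∫ z, Real.exp (n * (freeEnergy β h z - freeEnergy β h μ))) atTop atTop := by
  refine tendsto_atTop.2 fun M => ?_
  -- With zero second-order coefficient the integrand tends to 1 on every bounded u-window; one of
  -- length 2T > M beats the bound M.
  set T := |M| + 1
  have hT : 0 < T := by positivity
  set F : ℕ → ℝ → ℝ := fun n z => Real.exp (n * (freeEnergy β h z - freeEnergy β h μ)) with hF
  have hFc : ∀ n, Continuous (F n) := fun n =>
    Real.continuous_exp.comp (continuous_const.mul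
      ((continuous_freeEnergy β h).sub continuous_const))
  have hlim : Tendsto (fun n : ℕ => ∫ u in Icc (-T) T, F n (μ + (√(n : ℝ))⁻¹ * u)) atTop
      (𝓝 (∫ _u in Icc (-T) T, (1 : ℝ))) := by
    refine tendsto_integral_filter_of_dominated_convergence (fun _ => 1) ?_ ?_
      (integrableOn_const (by simp)) ?_
    · exact Eventually.of_forall fun n =>
        ((hFc n).comp (by fun_prop)).aestronglyMeasurable
    · refine Eventually.of_forall fun n => ae_of_all _ fun u => ?_
      rw [Real.norm_of_nonneg (Real.exp_pos _).le]
      refine Real.exp_le_one_iff.2 (mul_nonpos_of_nonneg_of_nonpos (Nat.cast_nonneg n) ?_)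
      linarith [hmax (μ + (√(n : ℝ))⁻¹ * u)]
    · refine ae_of_all _ fun u => ?_
      have h1 := (Real.continuous_exp.tendsto _).comp (tendsto_mul_freeEnergy_sub hfix u)
      simp only [hdeg, sub_self, mul_zero, neg_zero, zero_div, zero_mul, Real.exp_zero] at h1
      exact h1
  rw [setIntegral_const, measureReal_def, Real.volume_Icc, ENNReal.toReal_ofReal (by linarith),
    smul_eq_mul, mul_one] at hlim
  filter_upwards [hlim.eventually (lt_mem_nhds (show M < T - -T by
    simp only [T]; linarith [le_abs_self M, abs_nonneg M])), eventually_ne_atTop 0] with n hn hn0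
  refine hn.le.trans ?_
  rw [← integral_comp_add_inv_sqrt_mul hn0 μ (F n)]
  have hs : 0 < √(n : ℝ) := Real.sqrt_pos.2 (Nat.cast_pos.2 (Nat.pos_of_ne_zero hn0))
  refine setIntegral_le_integral ?_ (ae_of_all _ fun u => (Real.exp_pos _).le)
  exact ((integrable_exp_freeEnergy hn0 hβ h (freeEnergy β h μ)).comp_add_left μ).comp_mul_left'
    (inv_ne_zero hs.ne')

/-- At z = μ + u/√n the mean of the product law moves on the central-limit scale; the limit is the
drift entering the limiting Gaussian. -/
theorem tendsto_sqrt_mul_tanh_sub {β h μ : ℝ} (hfix : Real.tanh (β * μ + h) = μ) (u : ℝ) :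
    Tendsto (fun n : ℕ => √(n : ℝ) * (Real.tanh (β * (μ + (√(n : ℝ))⁻¹ * u) + h) - μ)) atTop
      (𝓝 (β * (1 - μ ^ 2) * u)) := by
  rcases eq_or_ne u 0 with rfl | hu
  · simp [hfix]
  have hd : HasDerivAt (fun z => Real.tanh (β * z + h)) (β * (1 - μ ^ 2)) μ := by
    have := (hasDerivAt_tanh_sub β h μ).add (hasDerivAt_id μ)
    rw [hfix] at this
    refine (this.congr_deriv (by ring)).congr_of_eventuallyEq (Eventually.of_forall fun z => ?_)
    simp
  have hne : Tendsto (fun n : ℕ => μ + (√(n : ℝ))⁻¹ * u) atTop (𝓝[≠] μ) := by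
    refine tendsto_nhdsWithin_iff.2 ⟨tendsto_add_mul_inv_sqrt μ u, ?_⟩
    filter_upwards [eventually_gt_atTop 0] with n hn
    have : 0 < √(n : ℝ) := Real.sqrt_pos.2 (Nat.cast_pos.2 hn)
    simp [hu, this.ne']
  refine (((hasDerivAt_iff_tendsto_slope.1 hd).comp hne).mul_const u).congr' ?_
  filter_upwards [eventually_gt_atTop 0] with n hn
  have : 0 < √(n : ℝ) := Real.sqrt_pos.2 (Nat.cast_pos.2 hn)
  simp only [Function.comp, slope_def_field, add_sub_cancel_left, hfix]
  field_simp

/-- At the critical point the error probability vanishes at threshold zero. -/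
theorem tendsto_errorProb_critical {p : ℝ} (hp0 : 0 ≤ p) (hp : p < 1 / 2) :
    Tendsto (errorProb 1 0 p 0) atTop (𝓝 0) := by
  have hfix : Real.tanh (1 * 0 + 0) = 0 := by simp
  have hmax : ∀ z, freeEnergy 1 0 z ≤ freeEnergy 1 0 0 := fun z => by
    by_cases hz : z = 0
    · rw [hz]
    · exact (freeEnergy_lt_zero_field one_pos le_rfl hz).le
  have hD := tendsto_sqrt_mul_integral_atTop one_pos hfix (by norm_num) hmax
  set c := (1 - 2 * p) ^ 2 / 16 with hc
  have hc0 : 0 < c := by have : 0 < 1 - 2 * p := by linarith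
                         positivity
  -- Cut at |z| = K/√n: the inner part has length 2K/√n and is negligible against the degenerate
  -- Laplace integral, the outer part is controlled by Chernoff. Letting n → ∞ leaves 2 exp(-c K²),
  -- and K is then taken large.
  have hbound : ∀ K : ℝ, 0 < K → ∀ n : ℕ, n ≠ 0 → errorProb 1 0 p 0 n ≤
      2 * K / (√(n : ℝ) * ∫ z, Real.exp (n * (freeEnergy 1 0 z - freeEnergy 1 0 0))) +
        2 * Real.exp (-(c * (√(n : ℝ) * Real.tanh ((√(n : ℝ))⁻¹ * K)) ^ 2)) := by
    intro K hK n hn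
    have hn' : 0 < (n : ℝ) := Nat.cast_pos.2 (Nat.pos_of_ne_zero hn)
    have hs : 0 < √(n : ℝ) := Real.sqrt_pos.2 hn'
    set E : ℝ → ℝ := fun z => Real.exp (n * (freeEnergy 1 0 z - freeEnergy 1 0 0)) with hE
    have hE0 : ∀ z, 0 < E z := fun z => Real.exp_pos _
    have hEint : Integrable E := integrable_exp_freeEnergy hn one_pos 0 _
    have hDpos : 0 < ∫ z, E z := integral_exp_freeEnergy_pos hn one_pos 0 _
    set a := (√(n : ℝ))⁻¹ * K with ha
    have ha0 : 0 < a := by positivity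
    set b := 2 * Real.exp (-(c * (√(n : ℝ) * Real.tanh a) ^ 2))
    have hb0 : 0 ≤ b := by positivity
    have hI : Integrable ((Icc (-a) a).indicator fun _ => (1 : ℝ)) :=
      (integrable_indicator_iff measurableSet_Icc).2 (integrableOn_const (by simp))
    have hint : ∫ z, (b * E z + (Icc (-a) a).indicator (fun _ => (1 : ℝ)) z) =
        b * (∫ z, E z) + 2 * a := by
      rw [integral_add (hEint.const_mul _) hI, integral_const_mul,
        integral_indicator measurableSet_Icc, setIntegral_const]
      rw [measureReal_def, Real.volume_Icc, ENNReal.toReal_ofReal (by linarith), smul_eq_mul]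
      ring
    have hnum : ∫ z, E z * iidError p 0 n (Real.tanh (1 * z + 0)) ≤ b * (∫ z, E z) + 2 * a := by
      rw [← hint]
      refine integral_mono
        (integrable_exp_freeEnergy_mul_iidError hn one_pos hp0 (by linarith) 0 0 _)
        ((hEint.const_mul _).add hI) fun z => ?_
      by_cases hz : z ∈ Icc (-a) a
      · have h1 : E z * iidError p 0 n (Real.tanh (1 * z + 0)) ≤ E z * 1 :=
          mul_le_mul_of_nonneg_left (iidError_le_one hp0 (by linarith) 0 n (tanh_mem_Icc _))
            (hE0 z).le
        have h2 : E z ≤ 1 := Real.exp_le_one_iff.2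
          (mul_nonpos_of_nonneg_of_nonpos hn'.le (by linarith [hmax z]))
        have h3 : 0 ≤ b * E z := mul_nonneg hb0 (hE0 z).le
        simp only [indicator_of_mem hz]
        linarith
      · simp only [indicator_of_notMem hz, add_zero]
        rw [mul_comm b]
        refine mul_le_mul_of_nonneg_left
          ((iidError_le (tanh_mem_Icc _) hp0 hp (by norm_num) hn).trans ?_) (hE0 z).le
        rw [sub_zero, one_mul, ← hc]
        refine mul_le_mul_of_nonneg_left (Real.exp_le_exp.2 (neg_le_neg ?_)) two_pos.le
        have ht0 : 0 ≤ Real.tanh a := by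
          rw [← Real.tanh_zero]; exact tanh_strictMono.monotone ha0.le
        have ht : Real.tanh a ^ 2 ≤ Real.tanh z ^ 2 := by
          rw [mem_Icc, not_and_or, not_le, not_le] at hz
          rcases hz with hz | hz
          · have := tanh_strictMono hz
            rw [Real.tanh_neg] at this
            nlinarith
          · exact pow_le_pow_left₀ ht0 (tanh_strictMono hz).le 2
        rw [mul_pow, Real.sq_sqrt hn'.le]
        calc c * (n * Real.tanh a ^ 2) ≤ c * (n * Real.tanh z ^ 2) := by gcongr
          _ = _ := by ring
    rw [errorProb_eq_div hn one_pos 0 p 0 (freeEnergy 1 0 0), div_le_iff₀ hDpos]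
    refine hnum.trans (le_of_eq ?_)
    rw [ha]
    field_simp
    ring
  have hlim : ∀ K : ℝ, 0 < K → Tendsto (fun n : ℕ =>
      2 * K / (√(n : ℝ) * ∫ z, Real.exp (n * (freeEnergy 1 0 z - freeEnergy 1 0 0))) +
        2 * Real.exp (-(c * (√(n : ℝ) * Real.tanh ((√(n : ℝ))⁻¹ * K)) ^ 2))) atTop
      (𝓝 (0 + 2 * Real.exp (-(c * K ^ 2)))) := by
    intro K _
    have h1 := tendsto_sqrt_mul_tanh_sub hfix K
    simp only [zero_add, one_mul, add_zero, sub_zero, ne_eq, OfNat.ofNat_ne_zero,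
      not_false_eq_true, zero_pow] at h1
    exact (hD.const_div_atTop _).add
      (((Real.continuous_exp.tendsto _).comp ((h1.pow 2).const_mul c).neg).const_mul 2)
  refine tendsto_order.2 ⟨fun a ha => Eventually.of_forall fun n =>
    ha.trans_le (errorProb_nonneg hp0 (by linarith) 0 n), fun ε hε => ?_⟩
  obtain ⟨K, hK, hKε⟩ : ∃ K : ℝ, 0 < K ∧ 0 + 2 * Real.exp (-(c * K ^ 2)) < ε := by
    have : Tendsto (fun K : ℝ => 0 + 2 * Real.exp (-(c * K ^ 2))) atTop (𝓝 (0 + 2 * 0)) :=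
      ((Real.tendsto_exp_neg_atTop_nhds_zero.comp
        ((tendsto_pow_atTop two_ne_zero).const_mul_atTop hc0)).const_mul 2).const_add 0
    exact ((eventually_gt_atTop 0).and
      (this.eventually (gt_mem_nhds (by simpa using hε)))).exists
  filter_upwards [(hlim K hK).eventually (gt_mem_nhds hKε), eventually_ne_atTop 0] with n h1 h2
  exact (hbound K hK n h2).trans_lt h1

/-! ### Central limit theorem for the joint fluctuations -/

/-- The law of a random vector on a finite probability space. -/
noncomputable def discreteLaw {ι E : Type*} [Fintype ι] [MeasurableSpace E] (w : ι → ℝ)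
    (V : ι → E) : Measure E :=
  ∑ i, ENNReal.ofReal (w i) • Measure.dirac (V i)

section discreteLaw

variable {ι E : Type*} [Fintype ι] [MeasurableSpace E] {w : ι → ℝ} {V : ι → E}

theorem isProbabilityMeasure_discreteLaw (hw : ∀ i, 0 ≤ w i) (h1 : ∑ i, w i = 1) :
    IsProbabilityMeasure (discreteLaw w V) := by
  refine ⟨?_⟩
  simp only [discreteLaw, Measure.coe_finsetSum, Finset.sum_apply, Measure.smul_apply,
    measure_univ, smul_eq_mul, mul_one]
  rw [← ENNReal.ofReal_sum_of_nonneg fun i _ => hw i, h1, ENNReal.ofReal_one]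

theorem discreteLaw_apply_toReal (hw : ∀ i, 0 ≤ w i) {A : Set E} [DecidablePred (· ∈ A)]
    (hA : MeasurableSet A) :
    (discreteLaw w V A).toReal = ∑ i, if V i ∈ A then w i else 0 := by
  simp only [discreteLaw, Measure.coe_finsetSum, Finset.sum_apply, Measure.smul_apply,
    smul_eq_mul, Measure.dirac_apply' _ hA]
  rw [ENNReal.toReal_sum fun i _ => ENNReal.mul_ne_top ENNReal.ofReal_ne_top (by
    by_cases h : V i ∈ A <;> simp [h])]
  refine Finset.sum_congr rfl fun i _ => ?_
  by_cases h : V i ∈ A <;> simp [h, hw i]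

theorem integral_discreteLaw [MeasurableSingletonClass E] (hw : ∀ i, 0 ≤ w i) (f : E → ℂ) :
    ∫ x, f x ∂(discreteLaw w V) = ∑ i, (w i : ℂ) * f (V i) := by
  rw [discreteLaw, integral_finsetSum_measure]
  · refine Finset.sum_congr rfl fun i _ => ?_
    rw [integral_smul_measure, integral_dirac, ENNReal.toReal_ofReal (hw i)]
    simp
  · intro i _
    exact (integrable_dirac (by simp)).smul_measure ENNReal.ofReal_ne_top

end discreteLaw

/-- The set where the threshold signs of the signal and of the noisy observation differ. -/
def mismatch (p : ℝ) : Set (ℝ × ℝ) :=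
  {v | SignType.sign v.1 ≠ SignType.sign ((1 - 2 * p) * v.1 + v.2)}

theorem measurableSet_mismatch (p : ℝ) : MeasurableSet (mismatch p) := by
  have hf : Measurable fun v : ℝ × ℝ => v.1 := measurable_fst
  have hg : Measurable fun v : ℝ × ℝ => (1 - 2 * p) * v.1 + v.2 := by fun_prop
  have h0 : Measurable fun _ : ℝ × ℝ => (0 : ℝ) := measurable_const
  have : mismatch p = (({v | 0 < v.1} ∩ {v | 0 < (1 - 2 * p) * v.1 + v.2}) ∪
      (({v | v.1 = 0} ∩ {v | (1 - 2 * p) * v.1 + v.2 = 0}) ∪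
        ({v | v.1 < 0} ∩ {v | (1 - 2 * p) * v.1 + v.2 < 0})))ᶜ := by
    ext v
    simp only [mismatch, mem_ofPred_eq, mem_compl_iff, mem_union, mem_inter_iff]
    generalize (1 - 2 * p) * v.1 + v.2 = y
    generalize v.1 = x
    rcases lt_trichotomy x 0 with hx | hx | hx <;> rcases lt_trichotomy y 0 with hy | hy | hy <;>
      simp [sign_pos, sign_neg, hx, hy, not_lt_of_gt, ne_of_lt, ne_of_gt]
  rw [this]
  exact (((measurableSet_lt h0 hf).inter (measurableSet_lt h0 hg)).union
    (((measurableSet_eq_fun hf h0).inter (measurableSet_eq_fun hg h0)).union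
      ((measurableSet_lt hf h0).inter (measurableSet_lt hg h0)))).compl

/-- Signs are locally constant where the two linear forms do not vanish. The two lines are null for
the limiting Gaussian, as the portmanteau theorem requires. -/
theorem frontier_mismatch_subset (p : ℝ) :
    frontier (mismatch p) ⊆ {v | v.1 = 0} ∪ {v | (1 - 2 * p) * v.1 + v.2 = 0} := by
  intro v hv
  by_contra hne
  simp only [mem_union, mem_ofPred_eq, not_or] at hne
  have key : ∀ f : ℝ × ℝ → ℝ, Continuous f → f v ≠ 0 →
      ∀ᶠ w in 𝓝 v, SignType.sign (f w) = SignType.sign (f v) := fun f hf hfv =>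
    ((continuousAt_sign_of_ne_zero hfv).comp hf.continuousAt).eventually
      ((isOpen_discrete {SignType.sign (f v)}).mem_nhds rfl)
  have h1 := key (fun w => w.1) continuous_fst hne.1
  have h2 := key (fun w => (1 - 2 * p) * w.1 + w.2) (by fun_prop) hne.2
  rw [frontier_eq_closure_inter_closure] at hv
  have a1 := (mem_closure_iff_frequently.1 hv.1).and_eventually (h1.and h2)
  have a2 := (mem_closure_iff_frequently.1 hv.2).and_eventually (h1.and h2)
  obtain ⟨x, hx, hx1, hx2⟩ := a1.exists
  obtain ⟨y, hy, hy1, hy2⟩ := a2.exists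
  refine hy ?_
  change SignType.sign y.1 ≠ SignType.sign ((1 - 2 * p) * y.1 + y.2)
  have hx' : SignType.sign x.1 ≠ SignType.sign ((1 - 2 * p) * x.1 + x.2) := hx
  rwa [hy1, hy2, ← hx1, ← hx2]

theorem gaussian_prod_frontier_mismatch (p m₁ m₂ : ℝ) {v₁ v₂ : NNReal} (h₁ : v₁ ≠ 0)
    (h₂ : v₂ ≠ 0) :
    ((gaussianReal m₁ v₁).prod (gaussianReal m₂ v₂)) (frontier (mismatch p)) = 0 := by
  refine measure_mono_null (frontier_mismatch_subset p) (measure_union_null ?_ ?_)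
  · have : ({v | v.1 = 0} : Set (ℝ × ℝ)) = {0} ×ˢ univ := by ext v; simp
    rw [this, Measure.prod_prod]
    rw [gaussianReal_absolutelyContinuous m₁ h₁ (by simp), zero_mul]
  · have hm : MeasurableSet {v : ℝ × ℝ | (1 - 2 * p) * v.1 + v.2 = 0} :=
      measurableSet_eq_fun (by fun_prop) measurable_const
    rw [Measure.measure_prod_null hm]
    refine ae_of_all _ fun w => ?_
    have : Prod.mk w ⁻¹' {v : ℝ × ℝ | (1 - 2 * p) * v.1 + v.2 = 0} = {-((1 - 2 * p) * w)} := by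
      ext y
      simp only [mem_preimage, mem_ofPred_eq, mem_singleton_iff]
      constructor <;> intro h <;> linarith
    change gaussianReal m₂ v₂ _ = 0
    rw [this]
    exact gaussianReal_absolutelyContinuous m₂ h₂ (by simp)

/-- The normalized fluctuations of the spin average and of the channel noise. -/
noncomputable def fluctuation (p S : ℝ) (n : ℕ) (ω : (Fin n → Bool) × (Fin n → Bool)) : ℝ × ℝ :=
  ((√(n : ℝ))⁻¹ * ∑ i, (spin (ω.1 i) - S),
    (√(n : ℝ))⁻¹ * ∑ i, (spin (ω.2 i) - (1 - 2 * p) * spin (ω.1 i)))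

/-- The combination (1 - 2p) · signal + noise restores the centred average of Y, and the factor √n >
0 does not affect signs. -/
theorem fluctuation_mem_mismatch {p S : ℝ} {n : ℕ} (hn : n ≠ 0)
    (ω : (Fin n → Bool) × (Fin n → Bool)) :
    fluctuation p S n ω ∈ mismatch p ↔ sentiment S ω.1 ≠ detector p S ω.2 := by
  have hn' : 0 < (n : ℝ) := Nat.cast_pos.2 (Nat.pos_of_ne_zero hn)
  have hs : 0 < √(n : ℝ) := Real.sqrt_pos.2 hn'
  have e1 : (fluctuation p S n ω).1 = √(n : ℝ) * (avgSpin ω.1 - S) := by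
    simp only [fluctuation, avgSpin, totalSpin, Finset.sum_sub_distrib]
    simp only [Finset.sum_const, Finset.card_univ, Fintype.card_fin, nsmul_eq_mul]
    field_simp
    rw [Real.sq_sqrt hn'.le]
  have e2 : (1 - 2 * p) * (fluctuation p S n ω).1 + (fluctuation p S n ω).2 =
      √(n : ℝ) * (avgSpin ω.2 - (1 - 2 * p) * S) := by
    simp only [fluctuation, avgSpin, totalSpin, Finset.sum_sub_distrib, ← Finset.mul_sum]
    simp only [Finset.sum_const, Finset.card_univ, Fintype.card_fin, nsmul_eq_mul]
    field_simp
    rw [Real.sq_sqrt hn'.le]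
    ring
  change SignType.sign _ ≠ SignType.sign _ ↔ _
  rw [e2, e1, sign_mul, sign_mul, sign_pos hs, one_mul, one_mul]
  rfl

/-- The third-order Taylor remainder is O(n^{-3/2}), so n times it vanishes. -/
theorem tendsto_mul_exp_sub (c : ℝ) :
    Tendsto (fun n : ℕ => (n : ℂ) * (Complex.exp (((√(n : ℝ))⁻¹ * c : ℝ) * Complex.I) - 1 -
      ((√(n : ℝ))⁻¹ * c : ℝ) * Complex.I + (((√(n : ℝ))⁻¹ * c : ℝ) : ℂ) ^ 2 / 2)) atTop
      (𝓝 0) := by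
  have hb : Tendsto (fun n : ℕ => |c| ^ 3 * ((√(n : ℝ))⁻¹ * Real.exp ((√(n : ℝ))⁻¹ * |c|)))
      atTop (𝓝 0) := by
    have h1 := tendsto_inv_sqrt_natCast
    have h2 := (Real.continuous_exp.tendsto _).comp (h1.mul_const |c|)
    have h3 := (h1.mul h2).const_mul (|c| ^ 3)
    simpa using h3
  refine squeeze_zero_norm' ?_ hb
  filter_upwards [eventually_ne_atTop 0] with n hn
  have hn' : 0 < (n : ℝ) := Nat.cast_pos.2 (Nat.pos_of_ne_zero hn)
  have hs : 0 < √(n : ℝ) := Real.sqrt_pos.2 hn'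
  set x : ℂ := ((√(n : ℝ))⁻¹ * c : ℝ) * Complex.I with hx
  have hxn : ‖x‖ = (√(n : ℝ))⁻¹ * |c| := by
    rw [hx, norm_mul, Complex.norm_I, mul_one, Complex.norm_real, Real.norm_eq_abs, abs_mul,
      abs_of_pos (inv_pos.2 hs)]
  have h := Complex.norm_exp_sub_sum_le_norm_mul_exp x 3
  have hsum : Complex.exp x - ∑ m ∈ Finset.range 3, x ^ m / (m.factorial : ℂ) =
      Complex.exp x - 1 - x + (((√(n : ℝ))⁻¹ * c : ℝ) : ℂ) ^ 2 / 2 := by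
    have : x ^ 2 = -(((√(n : ℝ))⁻¹ * c : ℝ) : ℂ) ^ 2 := by
      rw [hx, mul_pow, Complex.I_sq]; ring
    simp [Finset.sum_range_succ, Nat.factorial, this]
    ring
  rw [hsum, hxn] at h
  rw [norm_mul, Complex.norm_natCast]
  refine (mul_le_mul_of_nonneg_left h hn'.le).trans (le_of_eq ?_)
  have hsq : (n : ℝ) = √(n : ℝ) ^ 2 := (Real.sq_sqrt hn'.le).symm
  rw [mul_pow]
  generalize Real.exp _ = e
  nth_rw 1 [hsq]
  field_simp

/-- The one-site phase function of the characteristic function of the fluctuations. -/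
noncomputable def phase (p S t₁ t₂ : ℝ) (a b : Bool) : ℝ :=
  t₁ * (spin a - S) + t₂ * (spin b - (1 - 2 * p) * spin a)

theorem sum_pairWeight_mul_phase (m p S t₁ t₂ : ℝ) :
    ∑ a, ∑ b, pairWeight m p a b * phase p S t₁ t₂ a b = t₁ * (m - S) := by
  simp [pairWeight, phase, spin]; ring

/-- No t₁ t₂ term appears because the noise Y - (1 - 2p)X has conditional mean zero given X; this is
why signal and noise become independent in the limit. -/
theorem sum_pairWeight_mul_phase_sq (p S t₁ t₂ : ℝ) :
    ∑ a, ∑ b, pairWeight S p a b * phase p S t₁ t₂ a b ^ 2 =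
      t₁ ^ 2 * (1 - S ^ 2) + t₂ ^ 2 * (4 * p * (1 - p)) := by
  simp [pairWeight, phase, spin]; ring

theorem continuous_pairWeight (p : ℝ) (a b : Bool) : Continuous fun m => pairWeight m p a b := by
  unfold pairWeight; fun_prop

/-- Write the one-site characteristic function as 1 + g n. Then n · g n splits into a vanishing
Taylor remainder, the drift i t₁ √n (m n - S), and minus half the second moment, and (1 + g n)^n
tends to the exponential of the limit. -/
theorem tendsto_charFun_pow {p S L : ℝ} (t₁ t₂ : ℝ) {m : ℕ → ℝ}
    (hm : Tendsto (fun n : ℕ => √(n : ℝ) * (m n - S)) atTop (𝓝 L)) :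
    Tendsto (fun n : ℕ => (∑ a, ∑ b, (pairWeight (m n) p a b : ℂ) *
      Complex.exp (((√(n : ℝ))⁻¹ * phase p S t₁ t₂ a b : ℝ) * Complex.I)) ^ n) atTop
      (𝓝 (Complex.exp ((t₁ * L : ℝ) * Complex.I -
        ((t₁ ^ 2 * (1 - S ^ 2) + t₂ ^ 2 * (4 * p * (1 - p)) : ℝ) : ℂ) / 2))) := by
  have hmS : Tendsto m atTop (𝓝 S) := by
    have h1 := (tendsto_inv_sqrt_natCast.mul hm).add_const S
    rw [zero_mul, zero_add] at h1
    refine h1.congr' ?_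
    filter_upwards [eventually_gt_atTop 0] with n hn
    have : 0 < √(n : ℝ) := Real.sqrt_pos.2 (Nat.cast_pos.2 hn)
    field_simp
    ring
  set f := phase p S t₁ t₂ with hf
  set R : ℝ → ℕ → ℂ := fun c n => (n : ℂ) * (Complex.exp (((√(n : ℝ))⁻¹ * c : ℝ) * Complex.I) - 1 -
      ((√(n : ℝ))⁻¹ * c : ℝ) * Complex.I + (((√(n : ℝ))⁻¹ * c : ℝ) : ℂ) ^ 2 / 2) with hR
  have hw : ∀ a b, Tendsto (fun n => pairWeight (m n) p a b) atTop (𝓝 (pairWeight S p a b)) :=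
    fun a b => ((continuous_pairWeight p a b).tendsto S).comp hmS
  have hwc : ∀ a b, Tendsto (fun n => (pairWeight (m n) p a b : ℂ)) atTop
      (𝓝 (pairWeight S p a b : ℂ)) :=
    fun a b => (Complex.continuous_ofReal.tendsto _).comp (hw a b)
  have l1 : Tendsto (fun n => ∑ a, ∑ b, (pairWeight (m n) p a b : ℂ) * R (f a b) n) atTop
      (𝓝 0) := by
    have := tendsto_finsetSum Finset.univ fun a (_ : a ∈ (Finset.univ : Finset Bool)) =>
      tendsto_finsetSum Finset.univ fun b (_ : b ∈ (Finset.univ : Finset Bool)) =>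
        (hwc a b).mul (tendsto_mul_exp_sub (f a b))
    simp only [mul_zero, Finset.sum_const_zero] at this
    exact this
  have l2 : Tendsto (fun n : ℕ => ((t₁ * (√(n : ℝ) * (m n - S)) : ℝ) : ℂ) * Complex.I) atTop
      (𝓝 ((t₁ * L : ℝ) * Complex.I)) :=
    ((Complex.continuous_ofReal.tendsto _).comp (hm.const_mul t₁)).mul_const _
  have l3 : Tendsto (fun n => ((∑ a, ∑ b, pairWeight (m n) p a b * f a b ^ 2 : ℝ) : ℂ) / 2) atTop
      (𝓝 (((t₁ ^ 2 * (1 - S ^ 2) + t₂ ^ 2 * (4 * p * (1 - p)) : ℝ) : ℂ) / 2)) := by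
    rw [← sum_pairWeight_mul_phase_sq]
    exact ((Complex.continuous_ofReal.tendsto _).comp
      (tendsto_finsetSum Finset.univ fun a _ => tendsto_finsetSum Finset.univ fun b _ =>
        (hw a b).mul_const _)).div_const 2
  set g : ℕ → ℂ := fun n => (∑ a, ∑ b, (pairWeight (m n) p a b : ℂ) *
      Complex.exp (((√(n : ℝ))⁻¹ * f a b : ℝ) * Complex.I)) - 1 with hg
  have hgl : Tendsto (fun n : ℕ => (n : ℂ) * g n) atTop (𝓝 ((t₁ * L : ℝ) * Complex.I -
        ((t₁ ^ 2 * (1 - S ^ 2) + t₂ ^ 2 * (4 * p * (1 - p)) : ℝ) : ℂ) / 2)) := by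
    have l := (l1.add l2).sub l3
    rw [zero_add] at l
    refine l.congr' ?_
    filter_upwards [eventually_gt_atTop 0] with n hn
    have hn' : 0 < (n : ℝ) := Nat.cast_pos.2 hn
    have hs : 0 < √(n : ℝ) := Real.sqrt_pos.2 hn'
    have hone : (1 : ℂ) = ∑ a, ∑ b, (pairWeight (m n) p a b : ℂ) := by
      rw [← Complex.ofReal_one, ← sum_pairWeight (m n) p]; push_cast; rfl
    have hlin : ((t₁ * (√(n : ℝ) * (m n - S)) : ℝ) : ℂ) * Complex.I =
        ∑ a, ∑ b, (pairWeight (m n) p a b : ℂ) *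
          ((n : ℂ) * (((√(n : ℝ))⁻¹ * f a b : ℝ) * Complex.I)) := by
      have : t₁ * (√(n : ℝ) * (m n - S)) =
          ∑ a, ∑ b, pairWeight (m n) p a b * (n * ((√(n : ℝ))⁻¹ * f a b)) := by
        have e : (n : ℝ) * (√(n : ℝ))⁻¹ = √(n : ℝ) := by
          field_simp; rw [Real.sq_sqrt hn'.le]
        calc _ = √(n : ℝ) * ∑ a, ∑ b, pairWeight (m n) p a b * f a b := by
              rw [sum_pairWeight_mul_phase]; ring
          _ = _ := by
              simp_rw [← mul_assoc (n : ℝ), e, Finset.mul_sum]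
              refine Finset.sum_congr rfl fun a _ => Finset.sum_congr rfl fun b _ => ?_
              ring
      rw [this]
      push_cast
      simp_rw [Finset.sum_mul]
      refine Finset.sum_congr rfl fun a _ => Finset.sum_congr rfl fun b _ => ?_
      ring
    have hquad : ((∑ a, ∑ b, pairWeight (m n) p a b * f a b ^ 2 : ℝ) : ℂ) / 2 =
        ∑ a, ∑ b, (pairWeight (m n) p a b : ℂ) *
          ((n : ℂ) * ((((√(n : ℝ))⁻¹ * f a b : ℝ) : ℂ) ^ 2 / 2)) := by
      have : ∀ a b, (n : ℝ) * (((√(n : ℝ))⁻¹ * f a b) ^ 2) = f a b ^ 2 := by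
        intro a b
        rw [mul_pow, inv_pow, Real.sq_sqrt hn'.le]; field_simp
      have h2 : ∀ a b, (n : ℂ) * ((((√(n : ℝ))⁻¹ * f a b : ℝ) : ℂ) ^ 2 / 2) =
          ((f a b ^ 2 : ℝ) : ℂ) / 2 := by
        intro a b; rw [← this a b]; push_cast; ring
      simp_rw [h2]
      push_cast
      simp_rw [Finset.sum_div]
      refine Finset.sum_congr rfl fun a _ => Finset.sum_congr rfl fun b _ => ?_
      ring
    rw [hlin, hquad, hg]
    simp only
    rw [hone]
    simp only [Finset.mul_sum, ← Finset.sum_add_distrib, ← Finset.sum_sub_distrib, hR]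
    refine Finset.sum_congr rfl fun a _ => Finset.sum_congr rfl fun b _ => ?_
    ring
  have := Complex.tendsto_one_add_pow_exp_of_tendsto hgl
  simpa [hg] using this

/-- The joint law of the fluctuations. -/
noncomputable def fluctuationLaw (p S m : ℝ) (n : ℕ) : Measure (WithLp 2 (ℝ × ℝ)) :=
  discreteLaw (fun ω : (Fin n → Bool) × (Fin n → Bool) => bernWeight m ω.1 * channel p ω.1 ω.2)
    (fun ω => WithLp.toLp 2 (fluctuation p S n ω))

theorem charFun_fluctuationLaw {p m : ℝ} (hm : m ∈ Icc (-1 : ℝ) 1) (hp0 : 0 ≤ p) (hp1 : p ≤ 1)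
    (S : ℝ) (n : ℕ) (t : WithLp 2 (ℝ × ℝ)) :
    charFun (fluctuationLaw p S m n) t = (∑ a, ∑ b, (pairWeight m p a b : ℂ) *
      Complex.exp (((√(n : ℝ))⁻¹ * phase p S t.ofLp.1 t.ofLp.2 a b : ℝ) * Complex.I)) ^ n := by
  rw [charFun_apply, fluctuationLaw, integral_discreteLaw fun ω =>
    mul_nonneg (bernWeight_nonneg hm _) (channel_nonneg hp0 hp1 _ _), Fintype.sum_prod_type,
    ← sum_sum_prod]
  refine Finset.sum_congr rfl fun x _ => Finset.sum_congr rfl fun y _ => ?_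
  rw [Finset.prod_mul_distrib, ← Complex.exp_sum, bernWeight_mul_channel_eq_prod]
  push_cast
  congr 2
  rw [← Finset.sum_mul]
  congr 1
  rw [WithLp.prod_inner_apply]
  simp only [fluctuation, phase, RCLike.inner_apply, conj_trivial]
  push_cast
  simp only [Finset.mul_sum]
  rw [← Finset.sum_add_distrib]
  refine Finset.sum_congr rfl fun i _ => ?_
  ring

theorem iidError_eq_fluctuationLaw {p m : ℝ} (hm : m ∈ Icc (-1 : ℝ) 1) (hp0 : 0 ≤ p)
    (hp1 : p ≤ 1) (S : ℝ) {n : ℕ} (hn : n ≠ 0) :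
    iidError p S n m = (fluctuationLaw p S m n (WithLp.ofLp ⁻¹' mismatch p)).toReal := by
  classical
  rw [fluctuationLaw, discreteLaw_apply_toReal
    (fun ω => mul_nonneg (bernWeight_nonneg hm _) (channel_nonneg hp0 hp1 _ _))
    ((WithLp.measurable_ofLp 2 (ℝ × ℝ)) (measurableSet_mismatch p)), Fintype.sum_prod_type]
  refine Finset.sum_congr rfl fun x _ => Finset.sum_congr rfl fun y _ => ?_
  have := fluctuation_mem_mismatch (p := p) (S := S) hn (x, y)
  simp only [mem_preimage, this]

/-- The central limit theorem for the error probability of nearly threshold independent spins. -/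
theorem tendsto_iidError {p S L : ℝ} (hp0 : 0 < p) (hp : p < 1 / 2) (hS : S ∈ Ioo (-1 : ℝ) 1)
    {m : ℕ → ℝ} (hmI : ∀ n, m n ∈ Icc (-1 : ℝ) 1)
    (hm : Tendsto (fun n : ℕ => √(n : ℝ) * (m n - S)) atTop (𝓝 L)) :
    Tendsto (fun n => iidError p S n (m n)) atTop
      (𝓝 (((gaussianReal L (1 - S ^ 2).toNNReal).prod
        (gaussianReal 0 (4 * p * (1 - p)).toNNReal)) (mismatch p)).toReal) := by
  have hp1 : p ≤ 1 := by linarith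
  have hv₁ : 0 < 1 - S ^ 2 := by nlinarith [hS.1, hS.2]
  have hv₂ : 0 < 4 * p * (1 - p) := by nlinarith
  set γ := (gaussianReal L (1 - S ^ 2).toNNReal).prod
    (gaussianReal 0 (4 * p * (1 - p)).toNNReal) with hγ
  have hmeas : Measurable (WithLp.toLp 2 : ℝ × ℝ → WithLp 2 (ℝ × ℝ)) :=
    WithLp.measurable_toLp 2 (ℝ × ℝ)
  have hprob : ∀ n, IsProbabilityMeasure (fluctuationLaw p S (m n) n) := fun n =>
    isProbabilityMeasure_discreteLaw
      (fun ω => mul_nonneg (bernWeight_nonneg (hmI n) _) (channel_nonneg hp0.le hp1 _ _))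
      (by rw [Fintype.sum_prod_type]; exact sum_sum_bernWeight_mul_channel n (m n) p)
  have hprob' : IsProbabilityMeasure (γ.map (WithLp.toLp 2)) :=
    Measure.isProbabilityMeasure_map hmeas.aemeasurable
  -- Lévy's continuity theorem; the Euclidean structure on the product supplies the pairing in the
  -- characteristic function.
  have hweak : Tendsto (β := ProbabilityMeasure (WithLp 2 (ℝ × ℝ)))
      (fun n => ⟨fluctuationLaw p S (m n) n, hprob n⟩) atTop
      (𝓝 ⟨γ.map (WithLp.toLp 2), hprob'⟩) := by
    refine ProbabilityMeasure.tendsto_of_tendsto_charFun fun t => ?_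
    simp only [ProbabilityMeasure.coe_mk]
    rw [hγ, charFun_prod, charFun_gaussianReal, charFun_gaussianReal, ← Complex.exp_add]
    have := tendsto_charFun_pow (p := p) t.ofLp.1 t.ofLp.2 hm
    simp_rw [charFun_fluctuationLaw (hmI _) hp0.le hp1]
    convert! this using 3
    rw [Real.coe_toNNReal _ hv₁.le, Real.coe_toNNReal _ hv₂.le]
    push_cast
    ring
  have hhomeo : frontier (WithLp.ofLp ⁻¹' mismatch p : Set (WithLp 2 (ℝ × ℝ))) =
      WithLp.ofLp ⁻¹' frontier (mismatch p) :=
    ((WithLp.homeomorphProd 2 ℝ ℝ).preimage_frontier (mismatch p)).symm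
  have happ : ∀ B : Set (ℝ × ℝ), MeasurableSet B →
      γ.map (WithLp.toLp 2) (WithLp.ofLp ⁻¹' B) = γ B := fun B hB => by
    rw [Measure.map_apply hmeas ((WithLp.measurable_ofLp 2 (ℝ × ℝ)) hB)]
    rfl
  have hport := ProbabilityMeasure.tendsto_measure_of_null_frontier_of_tendsto' hweak
    (E := WithLp.ofLp ⁻¹' mismatch p) (by
      rw [hhomeo, ProbabilityMeasure.coe_mk, happ _ isClosed_frontier.measurableSet]
      exact gaussian_prod_frontier_mismatch p L 0 (by simpa using hv₁) (by simpa using hv₂))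
  simp only [ProbabilityMeasure.coe_mk] at hport
  rw [happ _ (measurableSet_mismatch p)] at hport
  refine ((ENNReal.tendsto_toReal (measure_ne_top γ _)).comp hport).congr' ?_
  filter_upwards [eventually_ne_atTop 0] with n hn
  rw [iidError_eq_fluctuationLaw (hmI n) hp0.le hp1 S hn]
  rfl

/-! ### Gaussian measure of the sign-mismatch cone -/

theorem gaussianPDF_mul_gaussianPDF (r θ : ℝ) :
    gaussianPDF 0 1 (r * Real.cos θ) * gaussianPDF 0 1 (r * Real.sin θ) =
      ENNReal.ofReal ((2 * Real.pi)⁻¹ * Real.exp (-r ^ 2 / 2)) := by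
  rw [gaussianPDF, gaussianPDF, ← ENNReal.ofReal_mul (gaussianPDFReal_nonneg _ _ _)]
  congr 1
  simp only [gaussianPDFReal, NNReal.coe_one, mul_one, sub_zero]
  rw [mul_mul_mul_comm, ← Real.exp_add, ← mul_inv,
    Real.mul_self_sqrt (by positivity)]
  congr 2
  have := Real.sin_sq_add_cos_sq θ
  linear_combination (-r ^ 2 / 2) * this

/-- The standard Gaussian measure of a cone in the plane is proportional to its angle. -/
theorem exists_gaussian_cone :
    ∃ R : ENNReal, ∀ (E : Set (ℝ × ℝ)) (Θ : Set ℝ), MeasurableSet E → MeasurableSet Θ →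
      (∀ r > 0, ∀ θ ∈ Ioo (-Real.pi) Real.pi, (r * Real.cos θ, r * Real.sin θ) ∈ E ↔ θ ∈ Θ) →
      ((gaussianReal 0 1).prod (gaussianReal 0 1)) E =
        R * volume (Θ ∩ Ioo (-Real.pi) Real.pi) := by
  -- The radial integral is left unevaluated; `gaussian_cone` finds it by taking the whole plane,
  -- where total mass 1 forces R · 2π = 1.
  refine ⟨∫⁻ r in Ioi (0 : ℝ), ENNReal.ofReal r *
    ENNReal.ofReal ((2 * Real.pi)⁻¹ * Real.exp (-r ^ 2 / 2)), fun E Θ hE hΘ h => ?_⟩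
  have hpm : Measurable (gaussianPDF 0 1) := measurable_gaussianPDF 0 1
  rw [gaussianReal_of_var_ne_zero 0 one_ne_zero, prod_withDensity hpm hpm,
    withDensity_apply _ hE, ← lintegral_indicator hE, ← Measure.volume_eq_prod,
    ← lintegral_comp_polarCoord_symm]
  have heq : ∀ q ∈ polarCoord.target, ENNReal.ofReal q.1 •
      E.indicator (fun z : ℝ × ℝ => gaussianPDF 0 1 z.1 * gaussianPDF 0 1 z.2)
        (polarCoord.symm q) =
      (ENNReal.ofReal q.1 * ENNReal.ofReal ((2 * Real.pi)⁻¹ * Real.exp (-q.1 ^ 2 / 2))) *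
        Θ.indicator 1 q.2 := by
    rintro ⟨r, θ⟩ ⟨hr, hθ⟩
    have hmem := h r hr θ hθ
    rw [polarCoord_symm_apply]
    simp only [smul_eq_mul]
    by_cases hθ' : θ ∈ Θ
    · rw [indicator_of_mem (hmem.2 hθ'), indicator_of_mem hθ', gaussianPDF_mul_gaussianPDF]
      simp
    · rw [indicator_of_notMem (fun hc => hθ' (hmem.1 hc)), indicator_of_notMem hθ']
      simp
  rw [setLIntegral_congr_fun polarCoord.open_target.measurableSet heq, polarCoord_target,
    Measure.volume_eq_prod, ← Measure.prod_restrict,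
    lintegral_prod_mul (f := fun r : ℝ => ENNReal.ofReal r *
      ENNReal.ofReal ((2 * Real.pi)⁻¹ * Real.exp (-r ^ 2 / 2))) (by fun_prop) (measurable_one.indicator hΘ).aemeasurable,
    lintegral_indicator hΘ, Measure.restrict_restrict hΘ]
  simp

theorem gaussian_cone {E : Set (ℝ × ℝ)} {Θ : Set ℝ} (hE : MeasurableSet E)
    (hΘ : MeasurableSet Θ)
    (h : ∀ r > 0, ∀ θ ∈ Ioo (-Real.pi) Real.pi,
      (r * Real.cos θ, r * Real.sin θ) ∈ E ↔ θ ∈ Θ) :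
    ((gaussianReal 0 1).prod (gaussianReal 0 1) E).toReal =
      (volume (Θ ∩ Ioo (-Real.pi) Real.pi)).toReal / (2 * Real.pi) := by
  obtain ⟨R, hR⟩ := exists_gaussian_cone
  have h1 := hR univ univ MeasurableSet.univ MeasurableSet.univ (by simp)
  rw [measure_univ, univ_inter, Real.volume_Ioo] at h1
  have h2 := congrArg ENNReal.toReal h1
  have hpi := Real.pi_pos
  rw [ENNReal.toReal_mul, ENNReal.toReal_ofReal (by linarith), ENNReal.toReal_one] at h2
  rw [hR E Θ hE hΘ h, ENNReal.toReal_mul]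
  field_simp
  linear_combination -(volume (Θ ∩ Ioo (-Real.pi) Real.pi)).toReal * h2

/-- The angles at which `cos θ` and `D cos θ + sin θ` have different signs. -/
theorem sign_cos_ne_iff {D : ℝ} (hD : 0 < D) {θ : ℝ} (hθ : θ ∈ Ioo (-Real.pi) Real.pi) :
    SignType.sign (Real.cos θ) ≠ SignType.sign (D * Real.cos θ + Real.sin θ) ↔
      θ ∈ Icc (-(Real.pi / 2)) (-Real.arctan D) ∪
        Icc (Real.pi / 2) (Real.pi - Real.arctan D) := by
  set α := Real.arctan D with hα
  have hα0 : 0 < α := Real.arctan_pos.2 hD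
  have hα1 : α < Real.pi / 2 := Real.arctan_lt_pi_div_two D
  have hcα : 0 < Real.cos α := Real.cos_arctan_pos D
  -- Phase shift by α = arctan D: the second sign is that of sin(θ + α). The arcs are closed because
  -- at an endpoint one sign is 0 and the other is not.
  have hsum : D * Real.cos θ + Real.sin θ = Real.sin (θ + α) / Real.cos α := by
    have : D = Real.sin α / Real.cos α := by rw [← Real.tan_eq_sin_div_cos, Real.tan_arctan]
    rw [this, Real.sin_add]
    field_simp
    ring
  have hsign : SignType.sign (D * Real.cos θ + Real.sin θ) =
      SignType.sign (Real.sin (θ + α)) := by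
    rw [hsum, div_eq_mul_inv, sign_mul, sign_pos (inv_pos.2 hcα), mul_one]
  rw [hsign, mem_union, mem_Icc, mem_Icc]
  obtain ⟨hθ1, hθ2⟩ := hθ
  have hsinpi : ∀ x, Real.sin x = -Real.sin (x - Real.pi) := fun x => by
    rw [Real.sin_sub_pi, neg_neg]
  rcases lt_or_ge θ (-(Real.pi / 2)) with h1 | h1
  · have hc : Real.cos θ < 0 := by
      rw [← Real.cos_neg]
      exact Real.cos_neg_of_pi_div_two_lt_of_lt (by linarith) (by linarith)
    have hs : Real.sin (θ + α) < 0 :=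
      Real.sin_neg_of_neg_of_neg_pi_lt (by linarith) (by linarith)
    rw [sign_neg hc, sign_neg hs]
    simp only [ne_eq, not_true_eq_false, false_iff, not_or, not_and, not_le]
    exact ⟨fun h => by linarith, fun h => by linarith⟩
  rcases le_or_gt θ (-α) with h2 | h2
  · refine iff_of_true ?_ (Or.inl ⟨h1, h2⟩)
    rcases h1.eq_or_lt with h3 | h3
    · rw [← h3, Real.cos_neg, Real.cos_pi_div_two, sign_zero,
        sign_neg (Real.sin_neg_of_neg_of_neg_pi_lt (by linarith) (by linarith))]
      decide
    · rw [sign_pos (Real.cos_pos_of_mem_Ioo ⟨h3, by linarith⟩)]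
      intro h4
      have := sign_eq_one_iff.1 h4.symm
      exact absurd this (not_lt.2
        (Real.sin_nonpos_of_nonpos_of_neg_pi_le (by linarith) (by linarith)))
  rcases lt_or_ge θ (Real.pi / 2) with h3 | h3
  · rw [sign_pos (Real.cos_pos_of_mem_Ioo ⟨by linarith, h3⟩),
      sign_pos (Real.sin_pos_of_pos_of_lt_pi (by linarith) (by linarith))]
    simp only [ne_eq, not_true_eq_false, false_iff, not_or, not_and, not_le]
    exact ⟨fun h => by linarith, fun h => by linarith⟩
  rcases le_or_gt θ (Real.pi - α) with h4 | h4
  · refine iff_of_true ?_ (Or.inr ⟨h3, h4⟩)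
    rcases h4.eq_or_lt with h5 | h5
    · have hc := Real.cos_neg_of_pi_div_two_lt_of_lt (show Real.pi / 2 < θ by linarith)
        (by linarith)
      rw [sign_neg hc, h5, sub_add_cancel, Real.sin_pi, sign_zero]
      decide
    · rw [sign_pos (Real.sin_pos_of_pos_of_lt_pi (by linarith) (by linarith))]
      intro h6
      exact absurd (sign_eq_one_iff.1 h6) (not_lt.2
        (Real.cos_nonpos_of_pi_div_two_le_of_le h3 (by linarith)))
  · have hc := Real.cos_neg_of_pi_div_two_lt_of_lt (show Real.pi / 2 < θ by linarith)
      (by linarith)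
    have hs : Real.sin (θ + α) < 0 := by
      rw [hsinpi]
      linarith [Real.sin_pos_of_pos_of_lt_pi (show 0 < θ + α - Real.pi by linarith)
        (by linarith)]
    rw [sign_neg hc, sign_neg hs]
    simp only [ne_eq, not_true_eq_false, false_iff, not_or, not_and, not_le]
    exact ⟨fun h => by linarith, fun h => by linarith⟩

theorem measurableSet_sign_ne {α : Type*} [MeasurableSpace α] {f g : α → ℝ} (hf : Measurable f)
    (hg : Measurable g) : MeasurableSet {a | SignType.sign (f a) ≠ SignType.sign (g a)} := by
  -- With p = 0 the set `mismatch` compares the signs of v.1 and v.1 + v.2, so the pair (f, g - f)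
  -- compares f with g.
  have := (hf.prodMk (hg.sub hf)) (measurableSet_mismatch 0)
  convert this using 1
  ext a
  simp [mismatch]

/-- Each of the two arcs has length π/2 - arctan D = arccot D, out of a full circle 2π. -/
theorem gaussian_sign_ne {D : ℝ} (hD : 0 < D) :
    ((gaussianReal 0 1).prod (gaussianReal 0 1)
      {v | SignType.sign v.1 ≠ SignType.sign (D * v.1 + v.2)}).toReal =
        1 / Real.pi * arccot D := by
  have hα0 : 0 < Real.arctan D := Real.arctan_pos.2 hD
  have hα1 : Real.arctan D < Real.pi / 2 := Real.arctan_lt_pi_div_two D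
  have hpi := Real.pi_pos
  rw [gaussian_cone (Θ := Icc (-(Real.pi / 2)) (-Real.arctan D) ∪
        Icc (Real.pi / 2) (Real.pi - Real.arctan D))
    (measurableSet_sign_ne measurable_fst (by fun_prop))
    (measurableSet_Icc.union measurableSet_Icc)]
  · rw [inter_eq_left.2, measure_union, Real.volume_Icc, Real.volume_Icc,
      ← ENNReal.ofReal_add (by linarith) (by linarith), ENNReal.toReal_ofReal (by linarith),
      arccot]
    · field_simp
      ring
    · exact Set.disjoint_left.2 fun x hx hx' => by linarith [hx.2, hx'.1]
    · exact measurableSet_Icc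
    · rintro x (hx | hx) <;> constructor <;> linarith [hx.1, hx.2]
  · intro r hr θ hθ
    rw [← sign_cos_ne_iff hD hθ]
    change SignType.sign (r * Real.cos θ) ≠
      SignType.sign (D * (r * Real.cos θ) + r * Real.sin θ) ↔ _
    rw [show D * (r * Real.cos θ) + r * Real.sin θ = r * (D * Real.cos θ + Real.sin θ) by ring,
      sign_mul, sign_mul r, sign_pos hr, one_mul, one_mul]

/-- The probability of a sign mismatch for independent Gaussian signal and noise. -/
theorem gaussian_mismatch {p σ v : ℝ} (hp : p < 1 / 2) (hσ : 0 < σ) (hv : 0 < v) :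
    ((gaussianReal 0 (σ ^ 2).toNNReal).prod (gaussianReal 0 v.toNNReal) (mismatch p)).toReal =
      1 / Real.pi * arccot ((1 - 2 * p) / √v * σ) := by
  have hs : 0 < √v := Real.sqrt_pos.2 hv
  have e1 : gaussianReal 0 (σ ^ 2).toNNReal = (gaussianReal 0 1).map (σ * ·) := by
    rw [gaussianReal_map_const_mul, mul_zero, mul_one]
    congr 1
    ext; simp [sq_nonneg]
  have e2 : gaussianReal 0 v.toNNReal = (gaussianReal 0 1).map (√v * ·) := by
    rw [gaussianReal_map_const_mul, mul_zero, mul_one]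
    congr 1
    ext; simp [hv.le]
  rw [e1, e2, Measure.map_prod_map _ _ (by fun_prop) (by fun_prop),
    Measure.map_apply (by fun_prop) (measurableSet_mismatch p),
    ← gaussian_sign_ne (D := (1 - 2 * p) / √v * σ)
      (mul_pos (div_pos (by linarith) hs) hσ)]
  congr 2
  ext w
  change SignType.sign (σ * w.1) ≠ SignType.sign ((1 - 2 * p) * (σ * w.1) + √v * w.2) ↔
    SignType.sign w.1 ≠ SignType.sign ((1 - 2 * p) / √v * σ * w.1 + w.2)
  rw [show (1 - 2 * p) * (σ * w.1) + √v * w.2 =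
    √v * ((1 - 2 * p) / √v * σ * w.1 + w.2) by field_simp, sign_mul, sign_mul (√v), sign_pos hσ,
    sign_pos hs, one_mul, one_mul]

/-- Mixing the mismatch probability over a Gaussian mean adds up the variances. -/
theorem integral_gaussian_mismatch {a s κ : ℝ} (hs : 0 < s) (hκ : 0 < κ) (p : ℝ) (v : NNReal) :
    ∫ u, Real.exp (-κ / 2 * u ^ 2) *
        ((gaussianReal (a * u) s.toNNReal).prod (gaussianReal 0 v) (mismatch p)).toReal =
      (∫ u, Real.exp (-κ / 2 * u ^ 2)) *
        ((gaussianReal 0 (a ^ 2 / κ + s).toNNReal).prod (gaussianReal 0 v)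
          (mismatch p)).toReal := by
  set k : ℝ → ℝ := fun w => (gaussianReal 0 v (Prod.mk w ⁻¹' mismatch p)).toReal with hk
  have hkm : Measurable k :=
    (measurable_measure_prodMk_left (measurableSet_mismatch p)).ennreal_toReal
  have hk1 : ∀ w, ‖k w‖ ≤ 1 := fun w => by
    rw [Real.norm_of_nonneg ENNReal.toReal_nonneg]
    exact ENNReal.toReal_le_of_le_ofReal zero_le_one (by simpa using prob_le_one)
  have hprod : ∀ (m : ℝ) (s : NNReal),
      ((gaussianReal m s).prod (gaussianReal 0 v) (mismatch p)).toReal =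
        ∫ w, k w ∂(gaussianReal m s) := by
    intro m s
    rw [Measure.prod_apply (measurableSet_mismatch p), integral_toReal
      (measurable_measure_prodMk_left (measurableSet_mismatch p)).aemeasurable
      (ae_of_all _ fun w => measure_lt_top _ _)]
  simp_rw [hprod]
  have hv0 : (κ⁻¹).toNNReal ≠ 0 := by simpa using hκ
  have hpdf : ∀ u, Real.exp (-κ / 2 * u ^ 2) =
      √(2 * Real.pi * κ⁻¹) * gaussianPDFReal 0 (κ⁻¹).toNNReal u := by
    intro u
    rw [gaussianPDFReal, Real.coe_toNNReal _ (inv_pos.2 hκ).le, mul_inv_cancel_left₀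
      (Real.sqrt_pos.2 (by positivity)).ne']
    congr 1
    field_simp
    ring
  have hconv : ∫ u, gaussianPDFReal 0 (κ⁻¹).toNNReal u *
      ∫ w, k w ∂(gaussianReal (a * u) s.toNNReal) =
      ∫ w, k w ∂(gaussianReal 0 (a ^ 2 / κ + s).toNNReal) := by
    have h1 := integral_gaussianReal_eq_integral_smul (μ := 0) hv0
      (f := fun u => ∫ w, k w ∂(gaussianReal (a * u) s.toNNReal))
    simp only [smul_eq_mul] at h1
    rw [← h1]
    have h2 : ∀ u, ∫ w, k w ∂(gaussianReal (a * u) s.toNNReal) =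
        ∫ w, k (a * u + w) ∂(gaussianReal 0 s.toNNReal) := by
      intro u
      have : gaussianReal (a * u) s.toNNReal = (gaussianReal 0 s.toNNReal).map (a * u + ·) := by
        rw [gaussianReal_map_const_add, zero_add]
      rw [this, integral_map (by fun_prop) hkm.aestronglyMeasurable]
    simp_rw [h2]
    -- The law of aU + W for independent U of variance 1/κ and W of variance s.
    have h3 : gaussianReal 0 (a ^ 2 / κ + s).toNNReal =
        Measure.conv ((gaussianReal 0 (κ⁻¹).toNNReal).map (a * ·)) (gaussianReal 0 s.toNNReal) := by
      rw [gaussianReal_map_const_mul, gaussianReal_conv_gaussianReal]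
      congr 1
      · simp
      · ext
        simp only [NNReal.coe_add, NNReal.coe_mul, NNReal.coe_mk]
        rw [Real.coe_toNNReal _ (by positivity), Real.coe_toNNReal _ (by positivity),
          Real.coe_toNNReal _ hs.le]
        rfl
    rw [h3, integral_conv, integral_map (by fun_prop)]
    · refine StronglyMeasurable.aestronglyMeasurable ?_
      have : Measurable (Function.uncurry fun u w : ℝ => k (u + w)) := hkm.comp measurable_add
      exact this.stronglyMeasurable.integral_prod_right
    · have : IsProbabilityMeasure ((gaussianReal 0 (κ⁻¹).toNNReal).map (a * ·)) :=
        Measure.isProbabilityMeasure_map (by fun_prop)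
      exact Integrable.of_bound hkm.aestronglyMeasurable 1 (ae_of_all _ hk1)
  simp_rw [hpdf, mul_assoc]
  rw [integral_const_mul, integral_const_mul, hconv, integral_gaussianPDFReal_eq_one 0 hv0, mul_one]

/-! ### Limits of the error probability -/

/-- The contribution to the error probability of the phase located at the threshold. -/
theorem tendsto_laplace_threshold {β h p μ : ℝ} (hβ : 0 < β) (hp0 : 0 < p) (hp : p < 1 / 2)
    (hμ : μ ∈ Ioo (-1 : ℝ) 1) (hfix : Real.tanh (β * μ + h) = μ) (hnd : β * (1 - μ ^ 2) < 1)
    {A : Set ℝ} (hA : IsClosed A) (hAμ : A ∈ 𝓝 μ)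
    (hmax : ∀ z ∈ A, z ≠ μ → freeEnergy β h z < freeEnergy β h μ) :
    Tendsto (fun n : ℕ => √(n : ℝ) * ∫ z in A,
        Real.exp (n * (freeEnergy β h z - freeEnergy β h μ)) *
          iidError p μ n (Real.tanh (β * z + h))) atTop
      (𝓝 ((∫ u, Real.exp (-(β * (1 - β * (1 - μ ^ 2))) / 2 * u ^ 2)) *
        (1 / Real.pi * arccot (channelD p * sigma β μ)))) := by
  have hs : 0 < 1 - μ ^ 2 := by nlinarith [hμ.1, hμ.2]
  have hκ : 0 < β * (1 - β * (1 - μ ^ 2)) := mul_pos hβ (by linarith)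
  have hd : 0 < 1 - β + β * μ ^ 2 := by nlinarith
  have hv : 0 < 4 * p * (1 - p) := by nlinarith
  have hσ : 0 < sigma β μ := Real.sqrt_pos.2 (div_pos hs hd)
  -- With q = 1 - μ², this reads βq²/(1 - βq) + q = q/(1 - βq).
  have hσ2 : (β * (1 - μ ^ 2)) ^ 2 / (β * (1 - β * (1 - μ ^ 2))) + (1 - μ ^ 2) =
      sigma β μ ^ 2 := by
    rw [sigma, Real.sq_sqrt (div_pos hs hd).le]
    have : 1 - β * (1 - μ ^ 2) ≠ 0 := by linarith
    have hd' : 1 - β + β * μ ^ 2 = 1 - β * (1 - μ ^ 2) := by ring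
    rw [hd']
    field_simp
    ring
  have key := tendsto_laplace hβ hfix hnd hA hAμ hmax
    (Q := fun n z => iidError p μ n (Real.tanh (β * z + h)))
    (fun n => measurable_iidError_tanh p μ n β h)
    (fun n z => iidError_nonneg hp0.le (by linarith) μ n (tanh_mem_Icc _))
    (fun n z => iidError_le_one hp0.le (by linarith) μ n (tanh_mem_Icc _))
    (fun u => tendsto_iidError hp0 hp hμ (fun n => tanh_mem_Icc _)
      (tendsto_sqrt_mul_tanh_sub hfix u))
  rw [integral_gaussian_mismatch hs hκ, hσ2, gaussian_mismatch hp hσ hv] at key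
  exact key

/-- The contribution to the partition function of a phase. -/
theorem tendsto_laplace_one {β h μ : ℝ} (hβ : 0 < β) (hfix : Real.tanh (β * μ + h) = μ)
    (hnd : β * (1 - μ ^ 2) < 1) {A : Set ℝ} (hA : IsClosed A) (hAμ : A ∈ 𝓝 μ)
    (hmax : ∀ z ∈ A, z ≠ μ → freeEnergy β h z < freeEnergy β h μ) :
    Tendsto (fun n : ℕ => √(n : ℝ) * ∫ z in A,
        Real.exp (n * (freeEnergy β h z - freeEnergy β h μ))) atTop
      (𝓝 (∫ u, Real.exp (-(β * (1 - β * (1 - μ ^ 2))) / 2 * u ^ 2))) := by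
  simpa using tendsto_laplace hβ hfix hnd hA hAμ hmax (Q := fun _ _ => 1) (q := fun _ => 1)
    (fun _ => measurable_const) (fun _ _ => zero_le_one) (fun _ _ => le_rfl)
    (fun _ => tendsto_const_nhds)

/-- A phase away from the threshold does not contribute to the error probability. -/
theorem tendsto_laplace_off_threshold {β h p S μ : ℝ} (hβ : 0 < β) (hp0 : 0 ≤ p)
    (hp : p < 1 / 2) (hS : S ∈ Ioo (-1 : ℝ) 1) (hSμ : S ≠ μ)
    (hfix : Real.tanh (β * μ + h) = μ) (hnd : β * (1 - μ ^ 2) < 1)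
    {A : Set ℝ} (hA : IsClosed A) (hAμ : A ∈ 𝓝 μ)
    (hmax : ∀ z ∈ A, z ≠ μ → freeEnergy β h z < freeEnergy β h μ) :
    Tendsto (fun n : ℕ => √(n : ℝ) * ∫ z in A,
        Real.exp (n * (freeEnergy β h z - freeEnergy β h μ)) *
          iidError p S n (Real.tanh (β * z + h))) atTop (𝓝 0) := by
  have key := tendsto_laplace hβ hfix hnd hA hAμ hmax (q := fun _ => 0)
    (Q := fun n z => iidError p S n (Real.tanh (β * z + h)))
    (fun n => measurable_iidError_tanh p S n β h)
    (fun n z => iidError_nonneg hp0 (by linarith) S n (tanh_mem_Icc _))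
    (fun n z => iidError_le_one hp0 (by linarith) S n (tanh_mem_Icc _)) ?_
  · simpa using key
  intro u
  have hm : Tendsto (fun n : ℕ => Real.tanh (β * (μ + (√(n : ℝ))⁻¹ * u) + h)) atTop (𝓝 μ) := by
    have hc : Continuous fun z => Real.tanh (β * z + h) := continuous_tanh.comp (by fun_prop)
    have := (hc.tendsto μ).comp (tendsto_add_mul_inv_sqrt μ u)
    rwa [hfix] at this
  have hp2 : 0 < 1 - 2 * p := by linarith
  have hpos : 0 < (1 - 2 * p) ^ 2 / 16 * (μ - S) ^ 2 := by
    have := sub_ne_zero.2 hSμ.symm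
    positivity
  have hlim : Tendsto (fun n : ℕ => 2 * Real.exp (-(n * ((1 - 2 * p) ^ 2 / 16 *
      (Real.tanh (β * (μ + (√(n : ℝ))⁻¹ * u) + h) - S) ^ 2)))) atTop (𝓝 (2 * 0)) := by
    refine (Real.tendsto_exp_neg_atTop_nhds_zero.comp ?_).const_mul 2
    exact tendsto_natCast_atTop_atTop.atTop_mul_pos hpos
      (((hm.sub_const S).pow 2).const_mul _)
  rw [mul_zero] at hlim
  refine squeeze_zero' (Eventually.of_forall fun n =>
    iidError_nonneg hp0 (by linarith) S n (tanh_mem_Icc _)) ?_ hlim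
  filter_upwards [eventually_ne_atTop 0] with n hn
  exact iidError_le (tanh_mem_Icc _) hp0 hp hS hn

theorem gaussianIntegral_pos {β μ : ℝ} (hβ : 0 < β) (hnd : β * (1 - μ ^ 2) < 1) :
    0 < ∫ u, Real.exp (-(β * (1 - β * (1 - μ ^ 2))) / 2 * u ^ 2) := by
  have hκ : 0 < β * (1 - β * (1 - μ ^ 2)) / 2 := half_pos (mul_pos hβ (by linarith))
  rw [neg_div]
  exact integral_exp_pos (integrable_exp_neg_mul_sq hκ)

/-- The limiting error probability at a unique nondegenerate maximizer. -/
theorem tendsto_errorProb_of_unique {β h p μ : ℝ} (hβ : 0 < β) (hp0 : 0 < p) (hp : p < 1 / 2)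
    (hμ : μ ∈ Ioo (-1 : ℝ) 1) (hfix : Real.tanh (β * μ + h) = μ) (hnd : β * (1 - μ ^ 2) < 1)
    (hmax : ∀ z, z ≠ μ → freeEnergy β h z < freeEnergy β h μ) :
    Tendsto (errorProb β h p μ) atTop
      (𝓝 (1 / Real.pi * arccot (channelD p * sigma β μ))) := by
  have h1 := tendsto_laplace_threshold hβ hp0 hp hμ hfix hnd isClosed_univ univ_mem
    fun z _ => hmax z
  have h2 := tendsto_laplace_one hβ hfix hnd isClosed_univ univ_mem fun z _ => hmax z
  have hG := (gaussianIntegral_pos hβ hnd).ne'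
  have h3 := h1.div h2 hG
  rw [mul_div_cancel_left₀ _ hG] at h3
  refine h3.congr' ?_
  filter_upwards [eventually_ne_atTop 0] with n hn
  have hs : √(n : ℝ) ≠ 0 :=
    (Real.sqrt_pos.2 (Nat.cast_pos.2 (Nat.pos_of_ne_zero hn))).ne'
  simp only [Pi.div_apply, setIntegral_univ]
  rw [mul_div_mul_left _ _ hs, errorProb_eq_div hn hβ h p μ (freeEnergy β h μ)]

/-- The limiting error probability at one of two symmetric nondegenerate maximizers. -/
theorem tendsto_errorProb_of_symmetric {β p ν : ℝ} (hβ : 0 < β) (hp0 : 0 < p) (hp : p < 1 / 2)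
    (hν : ν ∈ Ioo (-1 : ℝ) 1) (hν0 : ν ≠ 0) (hfix : Real.tanh (β * ν + 0) = ν)
    (hnd : β * (1 - ν ^ 2) < 1) {A B : Set ℝ} (hA : IsClosed A) (hB : IsClosed B)
    (hAν : A ∈ 𝓝 ν) (hBν : B ∈ 𝓝 (-ν))
    (hAB : ∀ F : ℝ → ℝ, Integrable F → ∫ z, F z = (∫ z in A, F z) + ∫ z in B, F z)
    (hmaxA : ∀ z ∈ A, z ≠ ν → freeEnergy β 0 z < freeEnergy β 0 ν)
    (hmaxB : ∀ z ∈ B, z ≠ -ν → freeEnergy β 0 z < freeEnergy β 0 ν) :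
    Tendsto (errorProb β 0 p ν) atTop
      (𝓝 (1 / (2 * Real.pi) * arccot (channelD p * sigma β ν))) := by
  have heven : freeEnergy β 0 (-ν) = freeEnergy β 0 ν := by rw [freeEnergy_neg, neg_zero]
  have hfix' : Real.tanh (β * -ν + 0) = -ν := by
    rw [show β * -ν + 0 = -(β * ν + 0) by ring, Real.tanh_neg, hfix]
  have hnd' : β * (1 - (-ν) ^ 2) < 1 := by rwa [neg_sq]
  have hmaxB' : ∀ z ∈ B, z ≠ -ν → freeEnergy β 0 z < freeEnergy β 0 (-ν) := by rwa [heven]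
  have a1 := tendsto_laplace_threshold hβ hp0 hp hν hfix hnd hA hAν hmaxA
  have a2 := tendsto_laplace_one hβ hfix hnd hA hAν hmaxA
  have hne : ν ≠ -ν := fun h => hν0 (by linarith)
  have b1 := tendsto_laplace_off_threshold hβ hp0.le hp hν hne hfix' hnd' hB hBν hmaxB'
  have b2 := tendsto_laplace_one hβ hfix' hnd' hB hBν hmaxB'
  rw [neg_sq] at b2
  rw [heven] at b1 b2
  have hG := (gaussianIntegral_pos hβ hnd).ne'
  -- The phase at -ν doubles the denominator but adds nothing to the numerator.
  have h3 := (a1.add b1).div (a2.add b2) (by rw [← two_mul]; exact mul_ne_zero two_ne_zero hG)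
  set G := ∫ u, Real.exp (-(β * (1 - β * (1 - ν ^ 2))) / 2 * u ^ 2)
  rw [show (G * (1 / Real.pi * arccot (channelD p * sigma β ν)) + 0) / (G + G) =
    1 / (2 * Real.pi) * arccot (channelD p * sigma β ν) by
      have := Real.pi_pos.ne'
      field_simp
      ring] at h3
  refine h3.congr' ?_
  filter_upwards [eventually_ne_atTop 0] with n hn
  have hs : √(n : ℝ) ≠ 0 :=
    (Real.sqrt_pos.2 (Nat.cast_pos.2 (Nat.pos_of_ne_zero hn))).ne'
  rw [errorProb_eq_div hn hβ 0 p ν (freeEnergy β 0 ν),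
    hAB _ (integrable_exp_freeEnergy hn hβ 0 _),
    hAB _ (integrable_exp_freeEnergy_mul_iidError hn hβ hp0.le (by linarith) 0 ν _)]
  simp only [Pi.div_apply]
  rw [← mul_add, ← mul_add, mul_div_mul_left _ _ hs]

theorem arccot_pos (x : ℝ) : 0 < arccot x := by
  rw [arccot]; linarith [Real.arctan_lt_pi_div_two x]

/-- Exponential decay of the error probability away from the maximizers. -/
theorem errorProb_off_maximizers {β h p S μ : ℝ} (hβ : 0 < β) (hp0 : 0 ≤ p) (hp : p < 1 / 2)
    (hS : S ∈ Ioo (-1 : ℝ) 1)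
    (hlt : Real.tanh (β * ((Real.artanh S - h) / β) + h) = S →
      freeEnergy β h ((Real.artanh S - h) / β) < freeEnergy β h μ) :
    Tendsto (errorProb β h p S) atTop (𝓝 0) ∧ errorRate β h p S < 0 := by
  have htS : Real.tanh (β * ((Real.artanh S - h) / β) + h) = S := by
    rw [mul_div_cancel₀ _ hβ.ne', sub_add_cancel, Real.tanh_artanh hS]
  obtain ⟨C, hC, c, hc, hle⟩ := exists_errorProb_le hβ hp0 hp hS (hlt htS)
  exact ⟨tendsto_errorProb_zero hp0 (by linarith) hc hle, errorRate_neg hC hc hle⟩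

end CurieWeiss

theorem mainTheorem9 (β h p : ℝ) (hβ : 0 < β) (hp0 : 0 ≤ p) (hp : p < 1 / 2) :
    -- the case `h ≠ 0` or `β ≤ 1`: a unique maximizer `μ`
    ((h ≠ 0 ∨ β ≤ 1) →
      ∃ μ ∈ Ioo (-1 : ℝ) 1, CurieWeiss.maximizers β h = {μ} ∧
        (∀ S ∈ Ioo (-1 : ℝ) 1, S ≠ μ →
          Tendsto (CurieWeiss.errorProb β h p S) atTop (𝓝 0) ∧
          CurieWeiss.errorRate β h p S < 0) ∧
        (∀ S ∈ Ioo (-1 : ℝ) 1, S = μ → 0 < p → ¬ (h = 0 ∧ β = 1) →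
          Tendsto (CurieWeiss.errorProb β h p S) atTop
            (𝓝 (1 / Real.pi *
              CurieWeiss.arccot (CurieWeiss.channelD p * CurieWeiss.sigma β μ))) ∧
          0 < 1 / Real.pi *
            CurieWeiss.arccot (CurieWeiss.channelD p * CurieWeiss.sigma β μ)) ∧
        -- the critical point, where `σ = +∞`: the limit is `0`, the value of `arccot` at `+∞`
        (∀ S ∈ Ioo (-1 : ℝ) 1, S = μ → h = 0 → β = 1 →
          Tendsto (CurieWeiss.errorProb β h p S) atTop (𝓝 0))) ∧
    -- the case `h = 0` and `β > 1`: exactly two maximizers `±μ` with `μ > 0`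
    (h = 0 → 1 < β →
      ∃ μ ∈ Ioo (0 : ℝ) 1, CurieWeiss.maximizers β h = {μ, -μ} ∧
        (∀ S ∈ Ioo (-1 : ℝ) 1, S ≠ μ → S ≠ -μ →
          Tendsto (CurieWeiss.errorProb β h p S) atTop (𝓝 0) ∧
          CurieWeiss.errorRate β h p S < 0) ∧
        (∀ S ∈ Ioo (-1 : ℝ) 1, S = μ ∨ S = -μ → 0 < p →
          Tendsto (CurieWeiss.errorProb β h p S) atTop
            (𝓝 (1 / (2 * Real.pi) *
              CurieWeiss.arccot (CurieWeiss.channelD p * CurieWeiss.sigma β μ))) ∧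
          0 < 1 / (2 * Real.pi) *
            CurieWeiss.arccot (CurieWeiss.channelD p * CurieWeiss.sigma β μ))) := by
  constructor
  · intro hor
    obtain ⟨μ, hμ, hfix, hμ0, hnd, hmax⟩ := CurieWeiss.exists_unique_max hβ hor
    refine ⟨μ, hμ, ?_, ?_, ?_, ?_⟩
    · refine CurieWeiss.maximizers_eq (singleton_nonempty μ) ?_ ?_ ?_
      · rintro _ rfl; exact hfix
      · rintro ν rfl z
        by_cases hz : z = ν
        · rw [hz]
        · exact (hmax z hz).le
      · rintro _ rfl z hz; exact hmax z hz
    · intro S hS hSμ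
      -- If z₀ were μ, the fixed-point equation would give S = tanh(β μ + h) = μ.
      refine CurieWeiss.errorProb_off_maximizers (μ := μ) hβ hp0 hp hS fun htS =>
        hmax _ fun hz => hSμ ?_
      rw [← htS, hz, hfix]
    · rintro S hS rfl hp0' hcrit
      exact ⟨CurieWeiss.tendsto_errorProb_of_unique hβ hp0' hp hμ hfix (hnd hcrit) hmax,
        mul_pos (by positivity) (CurieWeiss.arccot_pos _)⟩
    · rintro S hS rfl rfl rfl
      rw [hμ0 rfl]
      exact CurieWeiss.tendsto_errorProb_critical hp0 hp
  · rintro rfl hβ1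
    obtain ⟨μ, hμ, hfix, hnd, hmax⟩ := CurieWeiss.exists_max_nonneg hβ le_rfl (Or.inr hβ1)
    have heven : ∀ z, CurieWeiss.freeEnergy β 0 (-z) = CurieWeiss.freeEnergy β 0 z := fun z => by
      rw [CurieWeiss.freeEnergy_neg, neg_zero]
    have hfix' : Real.tanh (β * -μ + 0) = -μ := by
      rw [show β * -μ + 0 = -(β * μ + 0) by ring, Real.tanh_neg, hfix]
    have hmax' : ∀ z, z ≤ 0 → z ≠ -μ →
        CurieWeiss.freeEnergy β 0 z < CurieWeiss.freeEnergy β 0 μ := fun z hz hne => by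
      rw [← heven z]
      exact hmax _ (by linarith) fun h => hne (by linarith)
    have hlt : ∀ z, z ≠ μ → z ≠ -μ →
        CurieWeiss.freeEnergy β 0 z < CurieWeiss.freeEnergy β 0 μ := fun z h1 h2 => by
      rcases le_total 0 z with hz | hz
      · exact hmax z hz h1
      · exact hmax' z hz h2
    refine ⟨μ, hμ, ?_, ?_, ?_⟩
    · have hval : ∀ ν ∈ ({μ, -μ} : Set ℝ),
          CurieWeiss.freeEnergy β 0 ν = CurieWeiss.freeEnergy β 0 μ := by
        rintro ν (rfl | rfl)
        · rfl
        · exact heven μ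
      have hlt' : ∀ ν ∈ ({μ, -μ} : Set ℝ), ∀ z, z ∉ ({μ, -μ} : Set ℝ) →
          CurieWeiss.freeEnergy β 0 z < CurieWeiss.freeEnergy β 0 ν := fun ν hν z hz => by
        rw [hval ν hν]
        exact hlt z (fun h => hz (Or.inl h)) fun h => hz (Or.inr h)
      refine CurieWeiss.maximizers_eq ⟨μ, Or.inl rfl⟩ ?_ ?_ hlt'
      · rintro ν (rfl | rfl)
        · exact hfix
        · exact hfix'
      · intro ν hν z
        by_cases hz : z ∈ ({μ, -μ} : Set ℝ)
        · rw [hval ν hν, hval z hz]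
        · exact (hlt' ν hν z hz).le
    · intro S hS h1 h2
      refine CurieWeiss.errorProb_off_maximizers (μ := μ) hβ hp0 hp hS fun htS => hlt _ ?_ ?_
      · intro hz; apply h1; rw [← htS, hz, hfix]
      · intro hz; apply h2; rw [← htS, hz, hfix']
    · intro S hS hSμ hp0'
      refine ⟨?_, mul_pos (by have := Real.pi_pos; positivity) (CurieWeiss.arccot_pos _)⟩
      have hsplit : ∀ F : ℝ → ℝ, MeasureTheory.Integrable F →
          ∫ z, F z = (∫ z in Ici 0, F z) + ∫ z in Iic 0, F z := fun F hF => by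
        rw [MeasureTheory.integral_Ici_eq_integral_Ioi, add_comm]
        exact (intervalIntegral.integral_Iic_add_Ioi hF.integrableOn hF.integrableOn).symm
      rcases hSμ with rfl | rfl
      · exact CurieWeiss.tendsto_errorProb_of_symmetric hβ hp0' hp hS hμ.1.ne' hfix hnd
          isClosed_Ici isClosed_Iic (Ici_mem_nhds hμ.1) (Iic_mem_nhds (by linarith [hμ.1]))
          hsplit (fun z hz => hmax z hz) (fun z hz => hmax' z hz)
      -- For S = -μ the two half-lines exchange roles, and σ is even in μ.
      · have hσ : CurieWeiss.sigma β μ = CurieWeiss.sigma β (-μ) := by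
          simp only [CurieWeiss.sigma, neg_sq]
        rw [hσ]
        refine CurieWeiss.tendsto_errorProb_of_symmetric hβ hp0' hp hS
          (neg_ne_zero.2 hμ.1.ne') hfix' (by rwa [neg_sq]) isClosed_Iic isClosed_Ici
          (Iic_mem_nhds (neg_neg_of_pos hμ.1)) (by rw [neg_neg]; exact Ici_mem_nhds hμ.1)
          (fun F hF => by rw [hsplit F hF, add_comm]) ?_ ?_
        · intro z hz hne; rw [heven]; exact hmax' z hz hne
        · intro z hz hne; rw [heven]; exact hmax z hz (by rwa [neg_neg] at hne)
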